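/- All graphs are finite, simple and undirected. A graph is $2$-edge-connected if it is connected and has no bridge (the empty graph and a single vertex count as $2$-edge-connected); a bridge of a graph is an edge whose ends lie in different connected components after its deletion. For a graph $G$ with vertex set $V$ and edge set $E(G)$ let $$\mathrm{TECSP}(G)=\operatorname{conv}\{\chi^{H} \mid H\subseteq G \text{ is a $2$-edge-connected subgraph}\}\subseteq\mathbb{R}^{E(G)},$$ where $\chi^H_e=1$ if $e\in E(H)$ and $\chi^H_e=0$ otherwise. For $\emptyset\subsetneq S\subsetneq V$ let $\delta(S)$ be the set of edges of $G$ with exactly one end in $S$; such sets are called cuts. For $x\in\mathbb{R}^{E(G)}$ and $F\subseteq E(G)$ put $x(F)=\sum_{e\in F}x_e$. An inequality defines a facet of $\mathrm{TECSP}(G)$ if it is valid on $\mathrm{TECSP}(G)$ and the face where it holds with equality has dimension $\dim\mathrm{TECSP}(G)-1$. **Theorem.** Let $G$ be a $2$-edge-connected graph with vertex set $V$, and let $\emptyset\subsetneq S\subsetneq V$ be such that $\delta(S)$ is an inclusion-wise minimal cut. Let $e_1\in E(G[S])$ and $e_2\in E(G[V\setminus S])$. For $W\in\{S,V\setminus S\}$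 and a bridge $f\notin\{e_1,e_2\}$ of $G[W]$, let $\delta(W,f)\subseteq\delta(S)$ be the set of edges of $\delta(S)$ that have an end in the connected component of $G[W]-f$ containing neither $e_1$ nor $e_2$. Then the connectivity cut inequality $$2x_{e_1}-x(\delta(S))+2x_{e_2}\le 2$$ defines a facet of $\mathrm{TECSP}(G)$ if and only if one of the following two conditions holds: (i) $e_1$ is a bridge of $G[S]$ or $e_2$ is a bridge of $G[V\setminus S]$, and $|\delta(S)|=2$; (ii) $e_1$ is not a bridge of $G[S]$, $e_2$ is not a bridge of $G[V\setminus S]$, and every bridge $f$ of $G[W]$, for $W\in\{S,V\setminus S\}$, satisfies $|\delta(W,f)|=1$. -/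

import Mathlib

namespace TECS

open SimpleGraph

variable {V : Type*}

/-- The cut `δ(S)`: the edges of `G` with exactly one end in `S`. -/
def cut (G : SimpleGraph V) (S : Set V) : Set (Sym2 V) :=
  {e | e ∈ G.edgeSet ∧ ∃ u ∈ S, ∃ v ∉ S, e = s(u, v)}

/-- `F` is a cut of `G`, i.e. `F = δ(T)` for some `∅ ⊊ T ⊊ V`. -/
def IsCut (G : SimpleGraph V) (F : Set (Sym2 V)) : Prop :=
  ∃ T : Set V, T.Nonempty ∧ T ≠ Set.univ ∧ F = cut G T

/-- The induced subgraph `G[W]`. -/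
def ind (G : SimpleGraph V) (W : Set V) : G.Subgraph :=
  (⊤ : G.Subgraph).induce W

/-- `f` is a bridge of the subgraph `H`: an edge of `H` whose ends are not connected in `H - f`.
Passing to `spanningCoe` only adds isolated vertices to `H`. Mathlib's `IsBridge` does not say that
`f` is an edge, so this is required separately. -/
def IsBridgeOf {G : SimpleGraph V} (H : G.Subgraph) (f : Sym2 V) : Prop :=
  f ∈ H.edgeSet ∧ H.spanningCoe.IsBridge f

/-- The set `δ(W, f)` for a bridge `f` of `G[W]`: the edges of the cut `δ(W) = δ(V ∖ W)` that have
an end `w ∈ W` in the connected component of `G[W] - f` containing neither `e₁` nor `e₂`. -/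
def bridgeCut (G : SimpleGraph V) (W : Set V) (e₁ e₂ f : Sym2 V) : Set (Sym2 V) :=
  {d | d ∈ cut G W ∧ ∃ w ∈ W, w ∈ d ∧
    ∀ u, (u ∈ e₁ ∨ u ∈ e₂) → ¬ ((ind G W).deleteEdges {f}).spanningCoe.Reachable w u}

/-- The incidence vector `χ^H ∈ {0,1}^{E(G)}` of a subgraph. -/
noncomputable def incVec {G : SimpleGraph V} (H : G.Subgraph) : G.edgeSet → ℝ :=
  Set.indicator {e : G.edgeSet | (e : Sym2 V) ∈ H.edgeSet} 1

/-- The 2-edge-connected subgraph polytope: the convex hull of the incidence vectors of all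
2-edge-connected subgraphs of `G` (not necessarily spanning or induced; the empty graph and
single vertices count as 2-edge-connected). -/
def TECSP (G : SimpleGraph V) : Set (G.edgeSet → ℝ) :=
  convexHull ℝ {x | ∃ H : G.Subgraph, H.coe.IsEdgeConnected 2 ∧ x = incVec H}

/-- The linear functional `x ↦ x(F) = ∑_{e ∈ F} x_e`, for a set `F` of edges of a finite graph. -/
noncomputable def edgeSum (G : SimpleGraph V) (F : Set (Sym2 V)) :
    (G.edgeSet → ℝ) →ₗ[ℝ] ℝ :=
  ∑ᶠ (e : G.edgeSet) (_ : (e : Sym2 V) ∈ F), LinearMap.proj e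

/-- The left-hand side `x ↦ 2 x_{e₁} - x(δ(S)) + 2 x_{e₂}` of the connectivity cut inequality. -/
noncomputable def connectivityCutForm (G : SimpleGraph V) (S : Set V) (e₁ e₂ : G.edgeSet) :
    (G.edgeSet → ℝ) →ₗ[ℝ] ℝ :=
  (2 : ℝ) • LinearMap.proj e₁ - edgeSum G (cut G S) + (2 : ℝ) • LinearMap.proj e₂

section Polytope

variable {E : Type*} [AddCommGroup E] [Module ℝ E]

open Classical in
/-- The dimension of a subset of a finite-dimensional space: the dimension of its affine hull,
with `dim ∅ = -1`. -/
noncomputable def affDim (P : Set E) : ℤ :=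
  if P.Nonempty then (Module.finrank ℝ (affineSpan ℝ P).direction : ℤ) else -1

/-- The inequality `a x ≤ b` defines a facet of `P`: it is valid on `P`, and the face
`{x ∈ P | a x = b}` has dimension `dim P - 1`. -/
def DefinesFacet (P : Set E) (a : E →ₗ[ℝ] ℝ) (b : ℝ) : Prop :=
  (∀ x ∈ P, a x ≤ b) ∧ affDim {x | x ∈ P ∧ a x = b} = affDim P - 1

end Polytope

end TECS

/-!
The polytope contains the origin and the inequality has a nonzero right-hand side. Hence the
inequality, once valid, defines a facet if and only if every weight `c` on the edges that vanishes
on the *roots*, the 2-edge-connected sets attaining equality, vanishes on all 2-edge-connected sets.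

*Necessity.* Let `X` be a side of a bridge `f` of `G[W]`. When `X` contains neither `e₁` nor `e₂`,
or `f` is itself `e₁` or `e₂`, every root meets `δ(S) ∩ δ(X)` in as many edges as `{f}`. So the
weight `1_{δ(S) ∩ δ(X)} - 1_f` vanishes on the roots, hence on `G`, which gives
`|δ(S) ∩ δ(X)| = 1`.

*Sufficiency.* A weight that vanishes on all 2-edge-connected sets through some fixed edge vanishes
on all of them. If `|δ(S)| = 2` and `e₁` is a bridge, then all sets through `e₂` are roots.
Otherwise let `K₁` and `K₂`, the cores, be the 2-edge-connected components of `e₁` in `G[S]` and of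
`e₂` in `G[V ∖ S]`. A 2-edge-connected set with exactly two edges in `δ(S)` becomes a root when
`K₁ ∪ K₂` is added to it. By condition (ii) each part of `G[S]` outside `K₁` hangs on one edge and
meets `δ(S)` in one edge, so closed trails break up into excursions from a core, each of which can
be completed to a set using at most two edges of `δ(S)`. This yields
`c(F ∖ K₁) = c(F ∖ K₂) = c(F ∖ (K₁ ∪ K₂)) = 0`, and `c(F) = 0` by inclusion-exclusion.
-/

namespace TECS

open SimpleGraph

/-! ### Two-edge-connected edge sets -/

section EdgeSets

variable {V : Type*} {G : SimpleGraph V} {F F' J : Set (Sym2 V)} {X : Set V} {e f : Sym2 V}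
  {u v x : V}

/-- The vertices incident with an edge of `F`. -/
def verts (F : Set (Sym2 V)) : Set V := {v | ∃ e ∈ F, v ∈ e}

/-- `F` is the edge set of a 2-edge-connected subgraph of `G`. The connectivity is that of
`fromEdgeSet F`, a graph on all of `V`, hence required only between vertices incident with `F`. -/
structure TwoEdgeConnected (G : SimpleGraph V) (F : Set (Sym2 V)) : Prop where
  subset : F ⊆ G.edgeSet
  isEdgeReachable : ∀ u ∈ verts F, ∀ v ∈ verts F, (fromEdgeSet F).IsEdgeReachable 2 u v

theorem left_mem_verts (h : s(u, v) ∈ F) : u ∈ verts F := ⟨_, h, Sym2.mem_mk_left u v⟩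

theorem right_mem_verts (h : s(u, v) ∈ F) : v ∈ verts F := ⟨_, h, Sym2.mem_mk_right u v⟩

theorem verts_mono (h : F ⊆ F') : verts F ⊆ verts F' := fun _ ⟨e, he, hv⟩ => ⟨e, h he, hv⟩

theorem verts_union : verts (F ∪ F') = verts F ∪ verts F' := by
  ext v
  simp only [verts, Set.mem_ofPred_eq, Set.mem_union, or_and_right, exists_or]

theorem exists_mem_verts (he : e ∈ F) : ∃ v ∈ e, v ∈ verts F := by
  induction e with
  | h u v => exact ⟨u, Sym2.mem_mk_left u v, left_mem_verts he⟩

theorem disjoint_of_disjoint_verts (h : Disjoint (verts F) (verts F')) : Disjoint F F' := by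
  refine Set.disjoint_left.2 fun e he he' => ?_
  obtain ⟨v, hv, hvF⟩ := exists_mem_verts he
  exact Set.disjoint_left.1 h hvF ⟨e, he', hv⟩

theorem mem_support_of_mem_verts {p : G.Walk u v} (hx : x ∈ verts p.edgeSet) :
    x ∈ p.support :=
  p.mem_support_iff_exists_mem_edges.2 (.inr hx)

theorem mem_verts_of_mem_support {p : G.Walk u v} (hp : ¬ p.Nil) (hx : x ∈ p.support) :
    x ∈ verts p.edgeSet :=
  (p.mem_support_iff_exists_mem_edges_of_not_nil hp).1 hx

theorem reachable_of_edgeSet_subset (p : G.Walk u v) (hp : p.edgeSet ⊆ F) :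
    (fromEdgeSet F).Reachable u v :=
  ⟨p.transfer _ fun e he => by
    rw [edgeSet_fromEdgeSet]
    exact ⟨hp he, G.not_isDiag_of_mem_edgeSet (p.edges_subset_edgeSet he)⟩⟩

theorem exists_isPath_of_reachable (hF : F ⊆ G.edgeSet) (h : (fromEdgeSet F).Reachable u v) :
    ∃ p : G.Walk u v, p.IsPath ∧ p.edgeSet ⊆ F := by
  obtain ⟨p, hp⟩ := h.exists_isPath
  have hpF : p.edgeSet ⊆ F := fun e he =>
    (edgeSet_fromEdgeSet F ▸ p.edges_subset_edgeSet he).1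
  exact ⟨p.transfer G fun e he => hF (hpF he), hp.transfer _, by rwa [Walk.edgeSet_transfer]⟩

theorem reachable_mono (h : F ⊆ F') (huv : (fromEdgeSet F).Reachable u v) :
    (fromEdgeSet F').Reachable u v :=
  huv.mono (fromEdgeSet_mono h)

theorem reachable_of_mem (h : s(u, v) ∈ F) (huv : u ≠ v) : (fromEdgeSet F).Reachable u v :=
  Adj.reachable ((fromEdgeSet_adj F).2 ⟨h, huv⟩)

theorem isEdgeReachable_two_fromEdgeSet_iff :
    (fromEdgeSet F).IsEdgeReachable 2 u v ↔ ∀ e, (fromEdgeSet (F \ {e})).Reachable u v := by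
  simp only [isEdgeReachable_two, deleteEdges_fromEdgeSet]

namespace TwoEdgeConnected

theorem reachable_diff (h : TwoEdgeConnected G F) (hu : u ∈ verts F) (hv : v ∈ verts F)
    (e : Sym2 V) : (fromEdgeSet (F \ {e})).Reachable u v :=
  isEdgeReachable_two_fromEdgeSet_iff.1 (h.isEdgeReachable u hu v hv) e

theorem reachable (h : TwoEdgeConnected G F) (hu : u ∈ verts F) (hv : v ∈ verts F) :
    (fromEdgeSet F).Reachable u v :=
  (h.isEdgeReachable u hu v hv).reachable two_ne_zero

theorem sUnion {𝒥 : Set (Set (Sym2 V))} (h : ∀ J ∈ 𝒥, TwoEdgeConnected G J)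
    (hx : ∀ J ∈ 𝒥, x ∈ verts J) : TwoEdgeConnected G (⋃₀ 𝒥) where
  subset := Set.sUnion_subset fun J hJ => (h J hJ).subset
  isEdgeReachable := by
    have to_x : ∀ u ∈ verts (⋃₀ 𝒥), (fromEdgeSet (⋃₀ 𝒥)).IsEdgeReachable 2 u x := by
      rintro u ⟨e, ⟨J, hJ, he⟩, hu⟩
      exact ((h J hJ).isEdgeReachable u ⟨e, he, hu⟩ x (hx J hJ)).mono
        (fromEdgeSet_mono (Set.subset_sUnion_of_mem hJ))
    exact fun u hu v hv => (to_x u hu).trans (to_x v hv).symm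

theorem union (h : TwoEdgeConnected G F) (h' : TwoEdgeConnected G F') (hx : x ∈ verts F)
    (hx' : x ∈ verts F') : TwoEdgeConnected G (F ∪ F') := by
  rw [← Set.sUnion_pair]
  exact sUnion (x := x) (by simp [h, h']) (by simp [hx, hx'])

theorem of_isTrail {p : G.Walk u u} (hp : p.IsTrail) : TwoEdgeConnected G p.edgeSet where
  subset := p.edges_subset_edgeSet
  isEdgeReachable x hx y hy := by
    have hF : ∀ e ∈ p.edges, e ∈ (fromEdgeSet p.edgeSet).edgeSet := fun e he => by
      rw [edgeSet_fromEdgeSet]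
      exact ⟨he, G.not_isDiag_of_mem_edgeSet (p.edges_subset_edgeSet he)⟩
    have htrail : (p.transfer _ hF).IsTrail := by
      rw [Walk.isTrail_def, Walk.edges_transfer]
      exact hp.edges_nodup
    exact htrail.isEdgeReachable_two
      (by rw [Walk.support_transfer]; exact mem_support_of_mem_verts hx)
      (by rw [Walk.support_transfer]; exact mem_support_of_mem_verts hy)

theorem exists_isTrail_notMem (h : TwoEdgeConnected G F) (huv : s(u, v) ∈ F) :
    ∃ p : G.Walk v u, p.IsTrail ∧ p.edgeSet ⊆ F \ {s(u, v)} := by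
  obtain ⟨p, hp, hpF⟩ := exists_isPath_of_reachable (Set.sdiff_subset.trans h.subset)
    (h.reachable_diff (right_mem_verts huv) (left_mem_verts huv) s(u, v))
  exact ⟨p, hp.isTrail, hpF⟩

end TwoEdgeConnected

/-! ### Cuts -/

theorem mk_mem_cut_iff :
    s(u, v) ∈ cut G X ↔ G.Adj u v ∧ (u ∈ X ∧ v ∉ X ∨ u ∉ X ∧ v ∈ X) := by
  refine and_congr Iff.rfl ⟨?_, ?_⟩
  · rintro ⟨a, ha, b, hb, h⟩
    rcases Sym2.eq_iff.1 h with ⟨rfl, rfl⟩ | ⟨rfl, rfl⟩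
    · exact .inl ⟨ha, hb⟩
    · exact .inr ⟨hb, ha⟩
  · rintro (⟨hu, hv⟩ | ⟨hu, hv⟩)
    · exact ⟨u, hu, v, hv, rfl⟩
    · exact ⟨v, hv, u, hu, Sym2.eq_swap⟩

theorem cut_compl (X : Set V) : cut G Xᶜ = cut G X := by
  ext e
  induction e with
  | h u v => simp only [mk_mem_cut_iff, Set.mem_compl_iff, not_not, or_comm]

theorem exists_mem_cut_of_reachable (hF : F ⊆ G.edgeSet) (h : (fromEdgeSet F).Reachable u v)
    (hu : u ∈ X) (hv : v ∉ X) : ∃ e ∈ F, e ∈ cut G X := by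
  obtain ⟨p⟩ := h
  obtain ⟨d, -, hfst, hsnd⟩ := p.exists_boundary_dart X hu hv
  have hd : d.edge ∈ F := ((fromEdgeSet_adj F).1 d.adj).1
  exact ⟨d.edge, hd, hF hd, d.fst, hfst, d.snd, hsnd, rfl⟩

namespace TwoEdgeConnected

theorem exists_mem_cut (h : TwoEdgeConnected G F) (hu : u ∈ verts F) (hv : v ∈ verts F)
    (huX : u ∈ X) (hvX : v ∉ X) : ∃ e ∈ F, e ∈ cut G X :=
  exists_mem_cut_of_reachable h.subset (h.reachable hu hv) huX hvX

theorem exists_ne_mem_cut (h : TwoEdgeConnected G F) (he : e ∈ F) (heX : e ∈ cut G X) :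
    ∃ e' ∈ F, e' ≠ e ∧ e' ∈ cut G X := by
  obtain ⟨-, u, hu, v, hv, rfl⟩ := heX
  obtain ⟨e', ⟨he', hne⟩, heX'⟩ := exists_mem_cut_of_reachable (Set.sdiff_subset.trans h.subset)
    (h.reachable_diff (left_mem_verts he) (right_mem_verts he) s(u, v)) hu hv
  exact ⟨e', he', hne, heX'⟩

theorem mem_of_cut_eq_pair (h : TwoEdgeConnected G F) (hX : cut G X = {e, f}) (he : e ∈ F) :
    f ∈ F := by
  obtain ⟨e', he', hne, heX⟩ := h.exists_ne_mem_cut he (X := X) (by simp [hX])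
  rw [hX] at heX
  exact heX.resolve_left hne ▸ he'

end TwoEdgeConnected

end EdgeSets

/-! ### Trails through two-edge-connected sets -/

section Trails

variable {V : Type*} {G : SimpleGraph V} {A : Set V} {J R : Set (Sym2 V)} {a b u v w x y z : V}

theorem isTrail_append_iff {p : G.Walk u v} {q : G.Walk v w} :
    (p.append q).IsTrail ↔ p.IsTrail ∧ q.IsTrail ∧ Disjoint p.edgeSet q.edgeSet := by
  rw [Walk.isTrail_append, Set.disjoint_left]
  rfl

theorem edgeSet_rotate [DecidableEq V] (p : G.Walk u u) (hx : x ∈ p.support) :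
    (p.rotate x hx).edgeSet = p.edgeSet :=
  Set.ext fun _ => (p.rotate_edges x hx).mem_iff

/-- A walk is split at its first visit to `A`; before that visit it crosses the cut `δ(A)` at most
once, namely with the edge entering `A`. -/
theorem exists_append_first_visit (p : G.Walk u v) (hA : ∃ a ∈ p.support, a ∈ A) :
    ∃ w ∈ A, ∃ (q : G.Walk u w) (r : G.Walk w v), p = q.append r ∧
      (∀ a ∈ q.support, a ∈ A → a = w) ∧ (q.edgeSet ∩ cut G A).Subsingleton := by
  induction p with
  | @nil u =>
    have hu : u ∈ A := by simpa using hA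
    exact ⟨u, hu, .nil, .nil, by simp⟩
  | @cons u v _ h p ih =>
    by_cases hu : u ∈ A
    · exact ⟨u, hu, .nil, .cons h p, by simp⟩
    by_cases hv : v ∈ A
    · refine ⟨v, hv, .cons h .nil, p, by simp, by simp [hu], ?_⟩
      simp [Walk.edgeSet_cons, Set.subsingleton_singleton.anti Set.inter_subset_left]
    · obtain ⟨w, hw, q, r, rfl, hq, hcut⟩ := ih (by simpa [hu] using hA)
      refine ⟨w, hw, .cons h q, r, by simp, by simpa [hu] using hq, ?_⟩
      rwa [Walk.edgeSet_cons, Set.insert_inter_of_notMem]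
      simp [mk_mem_cut_iff, hu, hv]

theorem disjoint_edgeSet_of_first_visit {q : G.Walk u w} (hq : ∀ a ∈ q.support, a ∈ A → a = w)
    (hJ : ∀ e ∈ J, ∀ a ∈ e, a ∈ A) : Disjoint q.edgeSet J := by
  refine Set.disjoint_left.2 fun e he heJ => ?_
  induction e with
  | h x y =>
    have hx := hq x (q.fst_mem_support_of_mem_edges he) (hJ _ heJ x (Sym2.mem_mk_left x y))
    have hy := hq y (q.snd_mem_support_of_mem_edges he) (hJ _ heJ y (Sym2.mem_mk_right x y))
    exact (q.adj_of_mem_edges he).ne (hx.trans hy.symm)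

theorem exists_isTrail_of_detour {p : G.Walk u v} (hp : p.IsTrail) {d : G.Walk a w}
    (hd : d.IsTrail) (hdisj : Disjoint p.edgeSet d.edgeSet) (ha : a ∈ p.support)
    (hw : w ∈ p.support) :
    ∃ q : G.Walk u v, q.IsTrail ∧ d.edgeSet ⊆ q.edgeSet ∧ q.edgeSet ⊆ p.edgeSet ∪ d.edgeSet := by
  obtain ⟨p₁, p₂, rfl⟩ := Walk.mem_support_iff_exists_append.1 ha
  rw [isTrail_append_iff] at hp
  rw [Walk.edgeSet_append, Set.disjoint_union_left] at hdisj
  rcases (Walk.mem_support_append_iff _ _).1 hw with hw | hw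
  · obtain ⟨p₀, m, rfl⟩ := Walk.mem_support_iff_exists_append.1 hw
    rw [isTrail_append_iff, Walk.edgeSet_append, Set.disjoint_union_left] at hp
    rw [Walk.edgeSet_append, Set.disjoint_union_left] at hdisj
    refine ⟨p₀.append (d.reverse.append p₂), ?_, ?_, ?_⟩
    · simp only [isTrail_append_iff, Walk.edgeSet_append, Walk.edgeSet_reverse,
        Set.disjoint_union_right]
      exact ⟨hp.1.1, ⟨hd.reverse, hp.2.1, hdisj.2.symm⟩, hdisj.1.1, hp.2.2.1⟩
    all_goals
      simp only [Walk.edgeSet_append, Walk.edgeSet_reverse]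
      grind
  · obtain ⟨m, p₃, rfl⟩ := Walk.mem_support_iff_exists_append.1 hw
    rw [isTrail_append_iff, Walk.edgeSet_append, Set.disjoint_union_right] at hp
    rw [Walk.edgeSet_append, Set.disjoint_union_left] at hdisj
    refine ⟨p₁.append (d.append p₃), ?_, ?_, ?_⟩
    · simp only [isTrail_append_iff, Walk.edgeSet_append, Set.disjoint_union_right]
      exact ⟨hp.1, ⟨hd, hp.2.1.2.1, hdisj.2.2.symm⟩, hdisj.1, hp.2.2.2⟩
    all_goals
      simp only [Walk.edgeSet_append]
      grind

namespace TwoEdgeConnected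

/-- An edge `ab` leaving a trail starts a detour: it closes up to a trail, which is followed from
`b` until it meets the given trail again. -/
theorem exists_isTrail_mem_support_of_adj (hR : TwoEdgeConnected G R) {p : G.Walk y x}
    (hp : p.IsTrail) (hpR : p.edgeSet ⊆ R \ {s(x, y)}) (ha : a ∈ p.support) (hab : s(a, b) ∈ R) :
    ∃ q : G.Walk y x, q.IsTrail ∧ q.edgeSet ⊆ R \ {s(x, y)} ∧ b ∈ q.support := by
  by_cases hb : b ∈ p.support
  · exact ⟨p, hp, hpR, hb⟩
  obtain ⟨t, ht, htR⟩ := hR.exists_isTrail_notMem hab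
  obtain ⟨w, hw, q, r, rfl, hq, -⟩ :=
    exists_append_first_visit t (A := {c | c ∈ p.support}) ⟨a, by simp, ha⟩
  rw [Walk.edgeSet_append, Set.union_subset_iff] at htR
  have hp_support : ∀ e ∈ insert s(x, y) p.edgeSet, ∀ c ∈ e, c ∈ p.support := by
    rintro e (rfl | he) c hc
    · rcases Sym2.mem_iff.1 hc with rfl | rfl
      exacts [p.end_mem_support, p.start_mem_support]
    · exact Walk.mem_support_of_mem_edges he hc
  have hqp := disjoint_edgeSet_of_first_visit hq hp_support
  have habp : s(a, b) ∉ insert s(x, y) p.edgeSet := fun h =>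
    hb (hp_support _ h b (Sym2.mem_mk_right a b))
  have hadj : G.Adj a b := hR.subset hab
  have hdetour : (Walk.cons hadj q).edgeSet ⊆ R \ {s(x, y)} := by
    rw [Walk.edgeSet_cons, Set.insert_subset_iff, Set.subset_sdiff, Set.disjoint_singleton_right]
    exact ⟨⟨hab, fun h => habp (.inl h)⟩, htR.1.trans Set.sdiff_subset,
      fun h => Set.disjoint_left.1 hqp h (.inl rfl)⟩
  obtain ⟨p', hp', hsub, hp'R⟩ := exists_isTrail_of_detour hp (d := .cons hadj q)
    ((isTrail_append_iff.1 ht).1.cons hadj fun h => (htR.1 h).2 rfl)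
    (by
      rw [Walk.edgeSet_cons, Set.disjoint_insert_right]
      exact ⟨fun h => habp (.inr h), (hqp.mono_right (Set.subset_insert _ _)).symm⟩) ha hw
  have hmem : s(a, b) ∈ p'.edgeSet := hsub (by rw [Walk.edgeSet_cons]; exact .inl rfl)
  exact ⟨p', hp', hp'R.trans (Set.union_subset hpR hdetour), p'.snd_mem_support_of_mem_edges hmem⟩

theorem exists_isTrail_mem_support (hR : TwoEdgeConnected G R) (hxy : s(x, y) ∈ R)
    (hv : v ∈ verts R) :
    ∃ p : G.Walk y x, p.IsTrail ∧ p.edgeSet ⊆ R \ {s(x, y)} ∧ v ∈ p.support := by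
  by_contra hvA
  obtain ⟨t, ht, htR⟩ := hR.exists_isTrail_notMem hxy
  obtain ⟨_, habR, -, a, ⟨p, hp, hpR, ha⟩, b, hb, rfl⟩ := hR.exists_mem_cut
    (X := {v | ∃ p : G.Walk y x, p.IsTrail ∧ p.edgeSet ⊆ R \ {s(x, y)} ∧ v ∈ p.support})
    (left_mem_verts hxy) hv ⟨t, ht, htR, t.end_mem_support⟩ hvA
  exact hb (hR.exists_isTrail_mem_support_of_adj hp hpR ha habR)

/-- The case of two paths of Menger's theorem. -/
theorem exists_disjoint_isTrail (hJ : TwoEdgeConnected G J) (hz : z ∈ verts J) (hv : v ∈ verts J) :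
    ∃ (p : G.Walk z v) (q : G.Walk v z), p.IsTrail ∧ q.IsTrail ∧ Disjoint p.edgeSet q.edgeSet ∧
      p.edgeSet ⊆ J ∧ q.edgeSet ⊆ J ∧ ¬ p.Nil := by
  obtain ⟨e, he, y, rfl⟩ := hz
  obtain ⟨t, ht, htJ, hvt⟩ := hJ.exists_isTrail_mem_support he hv
  obtain ⟨p, q, rfl⟩ := Walk.mem_support_iff_exists_append.1 hvt
  rw [isTrail_append_iff] at ht
  rw [Walk.edgeSet_append, Set.union_subset_iff, Set.subset_sdiff, Set.subset_sdiff] at htJ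
  have hadj : G.Adj z y := hJ.subset he
  refine ⟨.cons hadj p, q, ht.1.cons hadj (by simpa using htJ.1.2), ht.2.1, ?_, ?_, htJ.2.1,
    by simp⟩
  · rw [Walk.edgeSet_cons, Set.disjoint_insert_left]
    exact ⟨by simpa using htJ.2.2, ht.2.2⟩
  · rw [Walk.edgeSet_cons]
    exact Set.insert_subset he htJ.1.1

end TwoEdgeConnected

end Trails

/-! ### Weights vanishing on two-edge-connected sets -/

section Weights

variable {V : Type*} {c : Sym2 V → ℝ} {F F' K : Set (Sym2 V)} {e : Sym2 V}

/-- The total weight of the edge set `F`, i.e. the value at its incidence vector of the linear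
functional with coefficients `c`. -/
noncomputable def weight (c : Sym2 V → ℝ) (F : Set (Sym2 V)) : ℝ := ∑ᶠ e ∈ F, c e

theorem weight_empty : weight c ∅ = 0 := finsum_mem_empty

theorem weight_singleton : weight c {e} = c e := finsum_mem_singleton

theorem weight_indicator : weight (K.indicator c) F = weight c (F ∩ K) := by
  rw [weight, weight, finsum_mem_def, finsum_mem_def, Set.indicator_indicator]

theorem weight_indicator_compl : weight (Kᶜ.indicator c) F = weight c (F \ K) := by
  rw [weight_indicator, Set.sdiff_eq]

variable [Finite V]

theorem weight_union (h : Disjoint F F') : weight c (F ∪ F') = weight c F + weight c F' :=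
  finsum_mem_union h (Set.toFinite _) (Set.toFinite _)

theorem weight_inter_add_weight_diff : weight c (F ∩ K) + weight c (F \ K) = weight c F :=
  finsum_mem_inter_add_sdiff K (Set.toFinite _)

theorem weight_union_eq_add_diff : weight c (F ∪ K) = weight c K + weight c (F \ K) := by
  rw [← weight_union Set.disjoint_sdiff_right, Set.union_sdiff_self, Set.union_comm]

theorem weight_one : weight (1 : Sym2 V → ℝ) F = F.ncard := by
  rw [weight, Set.ncard_eq_toFinset_card F, finsum_mem_eq_finite_toFinset_sum _ (Set.toFinite F)]
  simp

end Weights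

section Ears

variable {V : Type*} {G : SimpleGraph V} {c : Sym2 V → ℝ} {F J R : Set (Sym2 V)} {g : Sym2 V}
  {u v : V}

theorem twoEdgeConnected_union_of_isTrail {p : G.Walk u v} {q : G.Walk v u} (hp : p.IsTrail)
    (hq : q.IsTrail) (hpq : Disjoint p.edgeSet q.edgeSet) :
    TwoEdgeConnected G (p.edgeSet ∪ q.edgeSet) := by
  rw [← Walk.edgeSet_append]
  exact .of_isTrail (isTrail_append_iff.2 ⟨hp, hq, hpq⟩)

namespace TwoEdgeConnected

theorem exists_ear (hR : TwoEdgeConnected G R) (hJR : J ⊆ R) (hJ : J.Nonempty) (hg : g ∈ R)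
    (hgJ : g ∉ J) :
    ∃ z ∈ verts J, ∃ z' ∈ verts J, ∃ p : G.Walk z z', p.IsTrail ∧ g ∈ p.edgeSet ∧
      p.edgeSet ⊆ R ∧ Disjoint p.edgeSet J := by
  obtain ⟨e, he⟩ := hJ
  obtain ⟨v, -, hv⟩ := exists_mem_verts he
  induction g with
  | h x y =>
  obtain ⟨t, ht, htR, hvt⟩ := hR.exists_isTrail_mem_support hg (verts_mono hJR hv)
  obtain ⟨z', hz', q, r, rfl, hq, -⟩ := exists_append_first_visit t (A := verts J) ⟨v, hvt, hv⟩
  obtain ⟨z, hz, q', r', hr, hq', -⟩ :=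
    exists_append_first_visit r.reverse (A := verts J) ⟨z', by simp, hz'⟩
  have hq'r : q'.edgeSet ⊆ r.edgeSet := by
    rw [← Walk.edgeSet_reverse r, hr, Walk.edgeSet_append]
    exact Set.subset_union_left
  rw [isTrail_append_iff] at ht
  rw [Walk.edgeSet_append, Set.union_subset_iff, Set.subset_sdiff, Set.subset_sdiff,
    Set.disjoint_singleton_right, Set.disjoint_singleton_right] at htR
  have hq't : q'.IsTrail := (isTrail_append_iff.1 (hr ▸ ht.2.1.reverse)).1
  have hJ_verts : ∀ e ∈ J, ∀ a ∈ e, a ∈ verts J := fun e he a ha => ⟨e, he, ha⟩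
  have hadj : G.Adj x y := hR.subset hg
  refine ⟨z, hz, z', hz', q'.reverse.append (.cons hadj q), ?_, ?_, ?_, ?_⟩
  · rw [isTrail_append_iff, Walk.edgeSet_reverse, Walk.edgeSet_cons, Set.disjoint_insert_right]
    exact ⟨hq't.reverse, ht.1.cons hadj htR.1.2, fun h => htR.2.2 (hq'r h),
      (ht.2.2.mono_right hq'r).symm⟩
  · simp
  all_goals rw [Walk.edgeSet_append, Walk.edgeSet_reverse, Walk.edgeSet_cons]
  · exact Set.union_subset (hq'r.trans htR.2.1) (Set.insert_subset hg htR.1.1)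
  · rw [Set.disjoint_union_left, Set.disjoint_insert_left]
    exact ⟨disjoint_edgeSet_of_first_visit hq' hJ_verts, hgJ,
      disjoint_edgeSet_of_first_visit hq hJ_verts⟩

theorem union_ear (hJ : TwoEdgeConnected G J) {p : G.Walk u v} (hp : p.IsTrail)
    (hpJ : Disjoint p.edgeSet J) (hu : u ∈ verts J) (hv : v ∈ verts J) :
    TwoEdgeConnected G (J ∪ p.edgeSet) := by
  obtain ⟨q, -, hq, -, -, hqJ, -, hqnil⟩ := hJ.exists_disjoint_isTrail hv hu
  have hqp := twoEdgeConnected_union_of_isTrail hq hp (hpJ.mono_right hqJ).symm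
  have := hJ.union hqp hv (verts_mono Set.subset_union_left
    (mem_verts_of_mem_support hqnil q.start_mem_support))
  rwa [← Set.union_assoc, Set.union_eq_self_of_subset_right hqJ] at this

variable [Finite V]

/-- Attach to `J` an ear `D` through `g`, and let `P` and `Q` be edge-disjoint trails in `J` between
the ends of `D`. Since `c` vanishes on `D ∪ P`, on `D ∪ Q` and on `D ∪ P ∪ Q`, it vanishes on `D`,
and since it vanishes on `D ∪ J`, it vanishes on `J`. -/
theorem weight_eq_zero_of_through (hR : TwoEdgeConnected G R) (hg : g ∈ R)
    (hc : ∀ I, TwoEdgeConnected G I → I ⊆ R → g ∈ I → weight c I = 0)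
    (hJ : TwoEdgeConnected G J) (hJR : J ⊆ R) : weight c J = 0 := by
  rcases J.eq_empty_or_nonempty with rfl | hne
  · exact weight_empty
  by_cases hgJ : g ∈ J
  · exact hc J hJ hJR hgJ
  obtain ⟨z, hz, z', hz', d, hd, hgd, hdR, hdJ⟩ := hR.exists_ear hJR hne hg hgJ
  obtain ⟨p, q, hp, hq, hpq, hpJ, hqJ, hpnil⟩ := hJ.exists_disjoint_isTrail hz' hz
  have hdp := twoEdgeConnected_union_of_isTrail hd hp (hdJ.mono_right hpJ)
  have hdq := twoEdgeConnected_union_of_isTrail hd hq.reverse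
    (by rw [Walk.edgeSet_reverse]; exact hdJ.mono_right hqJ)
  rw [Walk.edgeSet_reverse] at hdq
  have mem_verts : ∀ a ∈ p.support, a ∈ verts (p.edgeSet ∪ q.edgeSet) := fun a ha =>
    verts_mono Set.subset_union_left (mem_verts_of_mem_support hpnil ha)
  have hpqd := (twoEdgeConnected_union_of_isTrail hp hq hpq).union_ear hd
    (hdJ.mono_right (Set.union_subset hpJ hqJ)) (mem_verts z p.end_mem_support)
    (mem_verts z' p.start_mem_support)
  have weight_add : ∀ I ⊆ J, TwoEdgeConnected G (d.edgeSet ∪ I) →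
      weight c d.edgeSet + weight c I = 0 := fun I hIJ hI => by
    rw [← weight_union (hdJ.mono_right hIJ)]
    exact hc _ hI (Set.union_subset hdR (hIJ.trans hJR)) (.inl hgd)
  have hpq0 := weight_add _ (Set.union_subset hpJ hqJ) (Set.union_comm _ _ ▸ hpqd)
  rw [weight_union hpq] at hpq0
  have hJ0 := weight_add J subset_rfl (Set.union_comm _ _ ▸ hJ.union_ear hd hdJ hz hz')
  linarith [weight_add _ hpJ hdp, weight_add _ hqJ hdq]

/-- With edge-disjoint trails `q` and `r` in `J` between the ends of the ear `p`, the weight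
vanishes on the closed trails `p ∪ q`, `p ∪ r` and `q ∪ r`, hence on `p`. -/
theorem weight_ear_eq_zero (hJ : TwoEdgeConnected G J) (hJF : J ⊆ F)
    (hc : ∀ (u : V) (p : G.Walk u u), p.IsTrail → p.edgeSet ⊆ F → weight c p.edgeSet = 0)
    {p : G.Walk u v} (hp : p.IsTrail) (hpF : p.edgeSet ⊆ F) (hpJ : Disjoint p.edgeSet J)
    (hu : u ∈ verts J) (hv : v ∈ verts J) : weight c p.edgeSet = 0 := by
  obtain ⟨q, r, hq, hr, hqr, hqJ, hrJ, -⟩ := hJ.exists_disjoint_isTrail hv hu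
  have weight_add : ∀ {a b : V} {s : G.Walk a b} {t : G.Walk b a}, s.IsTrail → t.IsTrail →
      Disjoint s.edgeSet t.edgeSet → s.edgeSet ⊆ F → t.edgeSet ⊆ F →
      weight c s.edgeSet + weight c t.edgeSet = 0 := by
    intro a b s t hs ht hst hsF htF
    rw [← weight_union hst, ← Walk.edgeSet_append]
    exact hc a _ (isTrail_append_iff.2 ⟨hs, ht, hst⟩)
      (by rw [Walk.edgeSet_append]; exact Set.union_subset hsF htF)
  have hpq := weight_add hp hq (hpJ.mono_right hqJ) hpF (hqJ.trans hJF)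
  have hpr := weight_add hp hr.reverse (by simpa using hpJ.mono_right hrJ) hpF
    (by simpa using hrJ.trans hJF)
  rw [Walk.edgeSet_reverse] at hpr
  linarith [weight_add hq hr hqr (hqJ.trans hJF) (hrJ.trans hJF)]

theorem weight_eq_zero_of_closed_trails (hF : TwoEdgeConnected G F)
    (hc : ∀ (u : V) (p : G.Walk u u), p.IsTrail → p.edgeSet ⊆ F → weight c p.edgeSet = 0) :
    weight c F = 0 := by
  rcases F.eq_empty_or_nonempty with rfl | ⟨e, he⟩
  · exact weight_empty
  induction e with
  | h x y =>
  obtain ⟨t, ht, htF⟩ := hF.exists_isTrail_notMem he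
  have hadj : G.Adj x y := hF.subset he
  have htrail : (Walk.cons hadj t).IsTrail := ht.cons hadj fun h => (htF h).2 rfl
  have htF' : (Walk.cons hadj t).edgeSet ⊆ F := by
    rw [Walk.edgeSet_cons]
    exact Set.insert_subset he (htF.trans Set.sdiff_subset)
  obtain ⟨J, ⟨hJ, hJF, hne, hcJ⟩, hmax⟩ := (Set.toFinite
    {J | TwoEdgeConnected G J ∧ J ⊆ F ∧ J.Nonempty ∧ weight c J = 0}).exists_maximal
    ⟨_, of_isTrail htrail, htF', ⟨s(x, y), by simp⟩, hc x _ htrail htF'⟩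
  suffices hFJ : F ⊆ J from hFJ.antisymm hJF ▸ hcJ
  by_contra hFJ
  obtain ⟨g, hg, hgJ⟩ := Set.not_subset.1 hFJ
  obtain ⟨z, hz, z', hz', p, hp, hgp, hpF, hpJ⟩ := hF.exists_ear hJF hne hg hgJ
  have hcp := hJ.weight_ear_eq_zero hJF hc hp hpF hpJ hz hz'
  exact hgJ (hmax ⟨hJ.union_ear hp hpJ hz hz', Set.union_subset hJF hpF, hne.inl,
    by rw [weight_union hpJ.symm, hcJ, hcp, add_zero]⟩ Set.subset_union_left (.inr hgp))

end TwoEdgeConnected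

end Ears

/-! ### Facets of polytopes containing the origin -/

section Facets

open Module Submodule

variable {E : Type*} [AddCommGroup E] [Module ℝ E] {X Y : Set E} {a : E →ₗ[ℝ] ℝ} {b : ℝ}

theorem convexHull_inter_hyperplane (hX : ∀ x ∈ X, a x ≤ b) :
    {x | x ∈ convexHull ℝ X ∧ a x = b} = convexHull ℝ {x | x ∈ X ∧ a x = b} := by
  refine Set.Subset.antisymm ?_ fun x hx => ⟨convexHull_mono (fun y hy => hy.1) hx,
    convexHull_min (fun y hy => hy.2) (convex_hyperplane a.isLinear b) hx⟩
  rintro x ⟨hx, hxb⟩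
  rw [convexHull_eq] at hx
  obtain ⟨ι, t, w, z, hw, hw1, hz, rfl⟩ := hx
  rw [t.centerMass_eq_of_sum_1 z hw1, map_sum] at hxb
  have hslack : ∑ i ∈ t, w i * (b - a (z i)) = 0 := by
    simp only [map_smul, smul_eq_mul] at hxb
    simp only [mul_sub, Finset.sum_sub_distrib, ← Finset.sum_mul, hw1, hxb, one_mul, sub_self]
  have hslack_zero := (Finset.sum_eq_zero_iff_of_nonneg fun i hi =>
    mul_nonneg (hw i hi) (sub_nonneg.2 (hX _ (hz i hi)))).1 hslack
  classical
  rw [← Finset.centerMass_filter_ne_zero]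
  refine Finset.centerMass_mem_convexHull _ (fun i hi => hw i (Finset.mem_of_mem_filter i hi))
    (by rw [Finset.sum_filter_ne_zero, hw1]; exact one_pos) fun i hi => ?_
  obtain ⟨hi, hwi⟩ := Finset.mem_filter.1 hi
  exact ⟨hz i hi, (sub_eq_zero.1 ((mul_eq_zero.1 (hslack_zero i hi)).resolve_left hwi)).symm⟩

theorem affDim_convexHull (hX : X.Nonempty) :
    affDim (convexHull ℝ X) = finrank ℝ (vectorSpan ℝ X) := by
  rw [affDim, if_pos hX.convexHull, affineSpan_convexHull, direction_affineSpan]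

theorem vectorSpan_eq_span_of_zero_mem (h0 : (0 : E) ∈ X) : vectorSpan ℝ X = span ℝ X := by
  rw [vectorSpan_eq_span_vsub_set_right ℝ h0]
  simp

theorem vectorSpan_sup_span_singleton {y : E} (hy : y ∈ Y) :
    vectorSpan ℝ Y ⊔ span ℝ {y} = span ℝ Y := by
  refine le_antisymm (sup_le ?_ (span_mono (Set.singleton_subset_iff.2 hy))) (span_le.2 ?_)
  · rw [vectorSpan_eq_span_vsub_set_right ℝ hy, span_le]
    rintro _ ⟨z, hz, rfl⟩
    exact sub_mem (subset_span hz) (subset_span hy)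
  · intro z hz
    have := add_mem (mem_sup_left (T := span ℝ {y}) (vsub_mem_vectorSpan ℝ hz hy))
      (mem_sup_right (mem_span_singleton_self y))
    rwa [vsub_eq_sub, sub_add_cancel] at this

theorem vectorSpan_le_ker (ha : ∀ y ∈ Y, a y = b) : vectorSpan ℝ Y ≤ LinearMap.ker a := by
  rw [vectorSpan, span_le]
  rintro _ ⟨y, hy, z, hz, rfl⟩
  simp [ha y hy, ha z hz]

theorem finrank_vectorSpan_add_one [FiniteDimensional ℝ E] (hY : Y.Nonempty) (hb : b ≠ 0)
    (ha : ∀ y ∈ Y, a y = b) : finrank ℝ (vectorSpan ℝ Y) + 1 = finrank ℝ (span ℝ Y) := by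
  obtain ⟨y, hy⟩ := hY
  have hay : a y ≠ 0 := ha y hy ▸ hb
  have hy0 : y ≠ 0 := fun h => hay (h ▸ map_zero a)
  have hinf : vectorSpan ℝ Y ⊓ span ℝ {y} = ⊥ := by
    rw [eq_bot_iff]
    rintro x ⟨hx, hxy⟩
    obtain ⟨t, rfl⟩ := mem_span_singleton.1 hxy
    have ht := vectorSpan_le_ker ha hx
    rw [LinearMap.mem_ker, map_smul, smul_eq_mul] at ht
    simp [(mul_eq_zero.1 ht).resolve_right hay]
  have := finrank_sup_add_finrank_inf_eq (vectorSpan ℝ Y) (span ℝ {y})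
  rw [vectorSpan_sup_span_singleton hy, hinf, finrank_bot, finrank_span_singleton hy0] at this
  omega

theorem affDim_convexHull_of_hyperplane [FiniteDimensional ℝ E] (hb : b ≠ 0)
    (ha : ∀ y ∈ Y, a y = b) : affDim (convexHull ℝ Y) = finrank ℝ (span ℝ Y) - 1 := by
  rcases Y.eq_empty_or_nonempty with rfl | hY
  · rw [convexHull_empty, affDim, if_neg Set.not_nonempty_empty, span_empty, finrank_bot]
    norm_num
  · rw [affDim_convexHull hY, ← finrank_vectorSpan_add_one hY hb ha]
    push_cast
    ring

theorem definesFacet_convexHull_iff [FiniteDimensional ℝ E] (h0 : (0 : E) ∈ X) (hb : b ≠ 0)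
    (hX : ∀ x ∈ X, a x ≤ b) :
    DefinesFacet (convexHull ℝ X) a b ↔ X ⊆ span ℝ {x | x ∈ X ∧ a x = b} := by
  have hvalid : ∀ x ∈ convexHull ℝ X, a x ≤ b := fun x hx =>
    convexHull_min hX (convex_halfSpace_le a.isLinear b) hx
  have hle : span ℝ {x | x ∈ X ∧ a x = b} ≤ span ℝ X := span_mono fun y hy => hy.1
  rw [DefinesFacet, convexHull_inter_hyperplane hX, affDim_convexHull ⟨0, h0⟩,
    vectorSpan_eq_span_of_zero_mem h0, affDim_convexHull_of_hyperplane hb fun y hy => hy.2]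
  constructor
  · rintro ⟨-, h⟩
    rw [eq_of_le_of_finrank_eq hle (by omega)]
    exact subset_span
  · intro h
    exact ⟨hvalid, by rw [le_antisymm hle (span_le.2 h)]⟩

theorem subset_span_iff_forall_linearMap :
    X ⊆ span ℝ Y ↔ ∀ f : E →ₗ[ℝ] ℝ, (∀ y ∈ Y, f y = 0) → ∀ x ∈ X, f x = 0 := by
  constructor
  · intro h f hf x hx
    have hker : span ℝ Y ≤ LinearMap.ker f := span_le.2 hf
    exact hker (h hx)
  · intro h x hx
    by_contra hn
    obtain ⟨f, hfx, hf⟩ := exists_le_ker_of_notMem hn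
    exact hfx (h f (fun y hy => hf (subset_span hy)) x hx)

end Facets

/-! ### Edge sets of subgraphs -/

section Subgraphs

variable {V : Type*} {G : SimpleGraph V} {F : Set (Sym2 V)} {W : Set V} {u v : V}

theorem twoEdgeConnected_edgeSet_of_isEdgeConnected (hG : G.IsEdgeConnected 2) :
    TwoEdgeConnected G G.edgeSet :=
  ⟨subset_rfl, fun u _ v _ => by simpa only [fromEdgeSet_edgeSet] using hG u v⟩

theorem verts_edgeSet_subset {H : G.Subgraph} : verts H.edgeSet ⊆ H.verts :=
  fun _ ⟨_, he, hv⟩ => H.mem_verts_of_mem_edge he hv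

theorem TwoEdgeConnected.edgeSet {H : G.Subgraph} (h : H.coe.IsEdgeConnected 2) :
    TwoEdgeConnected G H.edgeSet where
  subset := H.edgeSet_subset
  isEdgeReachable u hu v hv := by
    rw [isEdgeReachable_two_fromEdgeSet_iff]
    intro e
    have hdel := h ⟨u, verts_edgeSet_subset hu⟩ ⟨v, verts_edgeSet_subset hv⟩
      (s := {d | d.map (↑) = e}) <| ENat.lt_natCast_add_one_iff.2 <| Set.encard_le_one_iff.2
        fun d d' hd hd' => Sym2.map.injective Subtype.val_injective (hd.trans hd'.symm)
    exact hdel.map ⟨Subtype.val, fun {a b} hab => by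
      rw [deleteEdges_adj] at hab
      exact (fromEdgeSet_adj _).2 ⟨⟨hab.1, hab.2⟩, fun h => hab.1.ne (Subtype.ext h)⟩⟩

/-- The subgraph formed by an edge set and the ends of its edges. -/
def edgeSubgraph (hF : F ⊆ G.edgeSet) : G.Subgraph where
  verts := verts F
  Adj u v := s(u, v) ∈ F
  adj_sub h := hF h
  edge_vert h := left_mem_verts h
  symm := ⟨fun _ _ h => by rwa [Sym2.eq_swap]⟩

theorem edgeSet_edgeSubgraph (hF : F ⊆ G.edgeSet) : (edgeSubgraph hF).edgeSet = F := by
  ext e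
  induction e with
  | h u v => exact Iff.rfl

theorem TwoEdgeConnected.isEdgeConnected (h : TwoEdgeConnected G F) :
    (edgeSubgraph h.subset).coe.IsEdgeConnected 2 := by
  rw [isEdgeConnected_two]
  rintro e ⟨u, hu⟩ ⟨v, hv⟩
  obtain ⟨p⟩ := h.reachable_diff hu hv (e.map (↑))
  have hp : ∀ x ∈ p.support, x ∈ verts F := by
    intro x hx
    obtain rfl | ⟨d, hd, hxd⟩ := p.mem_support_iff_exists_mem_edges.1 hx
    · exact hv
    · exact ⟨d, (edgeSet_fromEdgeSet (F \ _) ▸ p.edges_subset_edgeSet hd).1.1, hxd⟩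
  refine (Walk.induce (verts F) p hp).reachable.mono fun a b hab => ?_
  obtain ⟨⟨habF, hne⟩, -⟩ := (fromEdgeSet_adj _).1 hab
  rw [deleteEdges_adj]
  refine ⟨habF, fun heq => hne ?_⟩
  rw [← Set.mem_singleton_iff.1 heq]
  rfl

theorem exists_subgraph_iff_twoEdgeConnected :
    (∃ H : G.Subgraph, H.coe.IsEdgeConnected 2 ∧ H.edgeSet = F) ↔ TwoEdgeConnected G F :=
  ⟨fun ⟨_, h, hF⟩ => hF ▸ .edgeSet h,
    fun h => ⟨_, h.isEdgeConnected, edgeSet_edgeSubgraph h.subset⟩⟩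

theorem mk_mem_edgeSet_ind_iff : s(u, v) ∈ (ind G W).edgeSet ↔ u ∈ W ∧ v ∈ W ∧ G.Adj u v := by
  simp [ind]

theorem disjoint_edgeSet_ind_cut : Disjoint (ind G W).edgeSet (cut G W) := by
  rw [Set.disjoint_left]
  rintro e he ⟨-, u, -, v, hv, rfl⟩
  exact hv (mk_mem_edgeSet_ind_iff.1 he).2.1

theorem TwoEdgeConnected.subset_edgeSet_ind (h : TwoEdgeConnected G F)
    (hF : Disjoint F (cut G W)) (hv : v ∈ verts F) (hvW : v ∈ W) : F ⊆ (ind G W).edgeSet := by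
  have hverts : ∀ x ∈ verts F, x ∈ W := by
    intro x hx
    by_contra hxW
    obtain ⟨e, he, heW⟩ := h.exists_mem_cut hv hx hvW hxW
    exact Set.disjoint_left.1 hF he heW
  intro e he
  induction e with
  | h a b =>
    exact mk_mem_edgeSet_ind_iff.2
      ⟨hverts a (left_mem_verts he), hverts b (right_mem_verts he), h.subset he⟩

end Subgraphs

/-! ### The facet condition in terms of weights -/

section Roots

variable {V : Type*} {G : SimpleGraph V} {S : Set V} {F : Set (Sym2 V)} {c : Sym2 V → ℝ}

/-- `F` is the edge set of a 2-edge-connected subgraph whose incidence vector satisfies the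
connectivity cut inequality with equality. -/
def IsRoot (G : SimpleGraph V) (S : Set V) (e₁ e₂ : Sym2 V) (F : Set (Sym2 V)) : Prop :=
  TwoEdgeConnected G F ∧ ((e₁ ∈ F ∧ e₂ ∈ F ∧ (F ∩ cut G S).ncard = 2) ∨
    ((e₁ ∈ F ∨ e₂ ∈ F) ∧ Disjoint F (cut G S)))

/-- The linear functional with coefficients `c` vanishes on the face of the connectivity cut
inequality. -/
def VanishesOnRoots (G : SimpleGraph V) (S : Set V) (e₁ e₂ : Sym2 V) (c : Sym2 V → ℝ) : Prop :=
  ∀ F, IsRoot G S e₁ e₂ F → weight c F = 0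

/-- The linear hull of the polytope is spanned by the roots, in dual form: a linear functional
that vanishes on the roots vanishes on the polytope. -/
def RootsDetermine (G : SimpleGraph V) (S : Set V) (e₁ e₂ : Sym2 V) : Prop :=
  ∀ c, VanishesOnRoots G S e₁ e₂ c → ∀ F, TwoEdgeConnected G F → weight c F = 0

section Symmetry

variable {e₁ e₂ : Sym2 V}

theorem isRoot_compl_iff : IsRoot G Sᶜ e₂ e₁ F ↔ IsRoot G S e₁ e₂ F := by
  rw [IsRoot, IsRoot, cut_compl, and_left_comm, or_comm (a := e₂ ∈ F)]

theorem vanishesOnRoots_compl_iff :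
    VanishesOnRoots G Sᶜ e₂ e₁ c ↔ VanishesOnRoots G S e₁ e₂ c := by
  simp only [VanishesOnRoots, isRoot_compl_iff]

theorem rootsDetermine_compl_iff : RootsDetermine G Sᶜ e₂ e₁ ↔ RootsDetermine G S e₁ e₂ := by
  simp only [RootsDetermine, vanishesOnRoots_compl_iff]

end Symmetry

theorem weight_edgeSet (c : Sym2 V → ℝ) (H : G.Subgraph) :
    weight c H.edgeSet = ∑ᶠ e : G.edgeSet, incVec H e * c e := by
  have h : ∀ e : G.edgeSet, incVec H e * c e = H.edgeSet.indicator c e := fun e => by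
    by_cases he : (e : Sym2 V) ∈ H.edgeSet <;> simp [incVec, he]
  simp only [h]
  rw [finsum_subtype_eq_finsum_cond (f := H.edgeSet.indicator c) (p := (· ∈ G.edgeSet))]
  change _ = weight (H.edgeSet.indicator c) G.edgeSet
  rw [weight_indicator, Set.inter_eq_right.2 H.edgeSet_subset]

variable [Finite V]

theorem exists_weight_eq_linearMap (f : (G.edgeSet → ℝ) →ₗ[ℝ] ℝ) :
    ∃ c : Sym2 V → ℝ, ∀ H : G.Subgraph, f (incVec H) = weight c H.edgeSet := by
  classical
  have := Fintype.ofFinite G.edgeSet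
  refine ⟨Function.extend Subtype.val (fun e : G.edgeSet => f (Pi.single e 1)) 0, fun H => ?_⟩
  rw [weight_edgeSet, finsum_eq_sum_of_fintype]
  simp only [Subtype.val_injective.extend_apply, ← smul_eq_mul, ← map_smul, ← map_sum]
  rw [← pi_eq_sum_univ']

theorem exists_linearMap_eq_weight (c : Sym2 V → ℝ) :
    ∃ f : (G.edgeSet → ℝ) →ₗ[ℝ] ℝ, ∀ H : G.Subgraph, f (incVec H) = weight c H.edgeSet := by
  have := Fintype.ofFinite G.edgeSet
  refine ⟨∑ e : G.edgeSet, c e • LinearMap.proj e, fun H => ?_⟩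
  rw [weight_edgeSet, finsum_eq_sum_of_fintype]
  simp [mul_comm]

theorem edgeSum_incVec (D : Set (Sym2 V)) (H : G.Subgraph) :
    edgeSum G D (incVec H) = (H.edgeSet ∩ D).ncard := by
  classical
  have := Fintype.ofFinite G.edgeSet
  rw [← weight_one, ← weight_indicator, weight_edgeSet, edgeSum, finsum_eq_sum_of_fintype,
    finsum_eq_sum_of_fintype, LinearMap.sum_apply]
  refine Finset.sum_congr rfl fun e _ => ?_
  by_cases he : (e : Sym2 V) ∈ D <;> simp [he]

theorem connectivityCutForm_incVec (S : Set V) (e₁ e₂ : G.edgeSet) (H : G.Subgraph) :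
    connectivityCutForm G S e₁ e₂ (incVec H) =
      2 * H.edgeSet.indicator 1 (e₁ : Sym2 V) - (H.edgeSet ∩ cut G S).ncard +
        2 * H.edgeSet.indicator 1 (e₂ : Sym2 V) := by
  rw [connectivityCutForm, LinearMap.add_apply, LinearMap.sub_apply, edgeSum_incVec]
  rfl

theorem TwoEdgeConnected.two_le_ncard_inter_cut {e : Sym2 V} (h : TwoEdgeConnected G F)
    (he : e ∈ F) (heS : e ∈ cut G S) : 2 ≤ (F ∩ cut G S).ncard := by
  obtain ⟨e', he', hne, heS'⟩ := h.exists_ne_mem_cut he heS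
  exact (Set.one_lt_ncard (Set.toFinite _)).2 ⟨e, ⟨he, heS⟩, e', ⟨he', heS'⟩, hne.symm⟩

theorem two_le_ncard_inter_cut_of_mem {e₁ e₂ : Sym2 V} (h : TwoEdgeConnected G F)
    (he₁ : e₁ ∈ (ind G S).edgeSet) (he₂ : e₂ ∈ (ind G Sᶜ).edgeSet) (h₁ : e₁ ∈ F) (h₂ : e₂ ∈ F) :
    2 ≤ (F ∩ cut G S).ncard := by
  obtain ⟨u, hu, huF⟩ := exists_mem_verts h₁
  obtain ⟨v, hv, hvF⟩ := exists_mem_verts h₂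
  obtain ⟨d, hd, hdS⟩ := h.exists_mem_cut huF hvF (verts_edgeSet_subset ⟨e₁, he₁, hu⟩)
    (verts_edgeSet_subset ⟨e₂, he₂, hv⟩)
  exact h.two_le_ncard_inter_cut hd hdS

variable {e₁ e₂ : G.edgeSet} {H : G.Subgraph}

theorem connectivityCutForm_incVec_le_two (hH : TwoEdgeConnected G H.edgeSet)
    (he₁ : (e₁ : Sym2 V) ∈ (ind G S).edgeSet) (he₂ : (e₂ : Sym2 V) ∈ (ind G Sᶜ).edgeSet) :
    connectivityCutForm G S e₁ e₂ (incVec H) ≤ 2 := by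
  have hcut : (0 : ℝ) ≤ (H.edgeSet ∩ cut G S).ncard := Nat.cast_nonneg _
  rw [connectivityCutForm_incVec]
  by_cases h₁ : (e₁ : Sym2 V) ∈ H.edgeSet <;> by_cases h₂ : (e₂ : Sym2 V) ∈ H.edgeSet <;>
    simp only [h₁, h₂, Set.indicator_of_mem, Set.indicator_of_notMem, not_false_eq_true,
      Pi.one_apply]
  · have : (2 : ℝ) ≤ (H.edgeSet ∩ cut G S).ncard := by
      exact_mod_cast two_le_ncard_inter_cut_of_mem hH he₁ he₂ h₁ h₂
    linarith
  all_goals linarith [hcut]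

theorem connectivityCutForm_incVec_eq_two_iff (hH : TwoEdgeConnected G H.edgeSet)
    (he₁ : (e₁ : Sym2 V) ∈ (ind G S).edgeSet) (he₂ : (e₂ : Sym2 V) ∈ (ind G Sᶜ).edgeSet) :
    connectivityCutForm G S e₁ e₂ (incVec H) = 2 ↔ IsRoot G S e₁ e₂ H.edgeSet := by
  have hdisj : Disjoint H.edgeSet (cut G S) ↔ (H.edgeSet ∩ cut G S).ncard = 0 := by
    rw [Set.ncard_eq_zero, Set.disjoint_iff_inter_eq_empty]
  have hcut : (0 : ℝ) ≤ (H.edgeSet ∩ cut G S).ncard := Nat.cast_nonneg _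
  have htwo := two_le_ncard_inter_cut_of_mem hH he₁ he₂
  rw [connectivityCutForm_incVec, IsRoot, hdisj]
  by_cases h₁ : (e₁ : Sym2 V) ∈ H.edgeSet <;> by_cases h₂ : (e₂ : Sym2 V) ∈ H.edgeSet <;>
    simp only [h₁, h₂, hH, Set.indicator_of_mem, Set.indicator_of_notMem, not_false_eq_true,
      Pi.one_apply, true_and, false_and, or_self, or_true, true_or, false_or, and_false, iff_false,
      ← Nat.cast_inj (R := ℝ), Nat.cast_ofNat, Nat.cast_zero]
  · have : (2 : ℝ) ≤ (H.edgeSet ∩ cut G S).ncard := by exact_mod_cast htwo h₁ h₂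
    grind
  all_goals grind

theorem definesFacet_iff_rootsDetermine (he₁ : (e₁ : Sym2 V) ∈ (ind G S).edgeSet)
    (he₂ : (e₂ : Sym2 V) ∈ (ind G Sᶜ).edgeSet) :
    DefinesFacet (TECSP G) (connectivityCutForm G S e₁ e₂) 2 ↔ RootsDetermine G S e₁ e₂ := by
  rw [TECSP, definesFacet_convexHull_iff _ two_ne_zero, subset_span_iff_forall_linearMap]
  · constructor
    · intro h c hc F hF
      obtain ⟨H, hH, rfl⟩ := exists_subgraph_iff_twoEdgeConnected.2 hF
      obtain ⟨f, hf⟩ := exists_linearMap_eq_weight (G := G) c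
      rw [← hf]
      refine h f ?_ _ ⟨H, hH, rfl⟩
      rintro _ ⟨⟨H', hH', rfl⟩, heq⟩
      rw [hf]
      exact hc _ ((connectivityCutForm_incVec_eq_two_iff (.edgeSet hH') he₁ he₂).1 heq)
    · rintro h f hf _ ⟨H, hH, rfl⟩
      obtain ⟨c, hc⟩ := exists_weight_eq_linearMap f
      rw [hc]
      refine h c (fun F hF => ?_) _ (.edgeSet hH)
      obtain ⟨H', hH', rfl⟩ := exists_subgraph_iff_twoEdgeConnected.2 hF.1
      rw [← hc]
      exact hf _ ⟨⟨H', hH', rfl⟩, (connectivityCutForm_incVec_eq_two_iff hF.1 he₁ he₂).2 hF⟩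
  · rintro _ ⟨H, hH, rfl⟩
    exact connectivityCutForm_incVec_le_two (.edgeSet hH) he₁ he₂
  · exact ⟨⊥, fun u => u.2.elim, by ext; simp [incVec]⟩

end Roots

/-! ### Sides of bridges -/

section Sides

variable {V : Type*} {G : SimpleGraph V} {F : Set (Sym2 V)} {S W X : Set V} {e e' f : Sym2 V}
  {a b r u v : V}

theorem spanningCoe_deleteEdges (H : G.Subgraph) (D : Set (Sym2 V)) :
    (H.deleteEdges D).spanningCoe = fromEdgeSet (H.edgeSet \ D) := by
  rw [← Subgraph.deleteEdges_spanningCoe_eq, ← fromEdgeSet_edgeSet (H.spanningCoe.deleteEdges D),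
    edgeSet_deleteEdges, Subgraph.edgeSet_spanningCoe]

theorem isBridgeOf_iff {H : G.Subgraph} :
    IsBridgeOf H s(u, v) ↔
      s(u, v) ∈ H.edgeSet ∧ ¬ (fromEdgeSet (H.edgeSet \ {s(u, v)})).Reachable u v := by
  rw [IsBridgeOf, isBridge_iff, Subgraph.deleteEdges_spanningCoe_eq, spanningCoe_deleteEdges]

/-- The induced subgraph `G[W]` is connected, in terms of its edge set. -/
def ConnectedOn (G : SimpleGraph V) (W : Set V) : Prop :=
  ∀ u ∈ W, ∀ v ∈ W, (fromEdgeSet (ind G W).edgeSet).Reachable u v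

/-- `X` is one of the two sides of the bridge `f` of `G[W]`. -/
structure IsSide (G : SimpleGraph V) (W : Set V) (f : Sym2 V) (X : Set V) : Prop where
  subset : X ⊆ W
  inter_cut : (ind G W).edgeSet ∩ cut G X = {f}

/-- The side of the bridge `f` of `G[W]` that contains `r`. -/
def nearSide (G : SimpleGraph V) (W : Set V) (f : Sym2 V) (r : V) : Set V :=
  {w | w ∈ W ∧ (fromEdgeSet ((ind G W).edgeSet \ {f})).Reachable w r}

/-- The side of the bridge `f` of `G[W]` that avoids the edge `e`. -/
def farSide (G : SimpleGraph V) (W : Set V) (e f : Sym2 V) : Set V :=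
  {w | w ∈ W ∧ ∀ u ∈ e, ¬ (fromEdgeSet ((ind G W).edgeSet \ {f})).Reachable w u}

theorem reachable_diff_left_or_right (h : (fromEdgeSet F).Reachable r a) :
    (fromEdgeSet (F \ {s(a, b)})).Reachable r a ∨
      (fromEdgeSet (F \ {s(a, b)})).Reachable r b := by
  obtain ⟨p⟩ := h
  obtain ⟨z, hz, q, -, -, hq, -⟩ := exists_append_first_visit p (A := {a, b}) ⟨a, by simp, by simp⟩
  have hab : Disjoint q.edgeSet {s(a, b)} := disjoint_edgeSet_of_first_visit hq (by simp)
  have hqF : q.edgeSet ⊆ F := fun e he =>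
    (edgeSet_fromEdgeSet F ▸ q.edges_subset_edgeSet he).1
  have hrz := reachable_of_edgeSet_subset q (F := F \ {s(a, b)}) <| Set.subset_sdiff.2
    ⟨hqF, hab⟩
  rcases hz with rfl | rfl
  exacts [.inl hrz, .inr hrz]

theorem isSide_nearSide (hW : ConnectedOn G W) (hf : IsBridgeOf (ind G W) f) (hr : r ∈ W) :
    IsSide G W f (nearSide G W f r) := by
  induction f with
  | h a b =>
  obtain ⟨hab, hnot⟩ := isBridgeOf_iff.1 hf
  obtain ⟨haW, hbW, hadj⟩ := mk_mem_edgeSet_ind_iff.1 hab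
  refine ⟨fun x hx => hx.1, Set.Subset.antisymm ?_ (Set.singleton_subset_iff.2 ⟨hab, ?_⟩)⟩
  · rintro e ⟨he, -, x, hx, y, hy, rfl⟩
    by_contra hne
    obtain ⟨-, hyW, hxy⟩ := mk_mem_edgeSet_ind_iff.1 he
    have hxy' : (fromEdgeSet ((ind G W).edgeSet \ {s(a, b)})).Reachable x y :=
      reachable_of_mem ⟨he, hne⟩ hxy.ne
    exact hy ⟨hyW, hxy'.symm.trans hx.2⟩
  · rw [mk_mem_cut_iff]
    refine ⟨hadj, ?_⟩
    rcases reachable_diff_left_or_right (b := b) (hW r hr a haW) with h | h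
    · exact .inl ⟨⟨haW, h.symm⟩, fun hb => hnot (h.symm.trans hb.2.symm)⟩
    · exact .inr ⟨fun ha => hnot (ha.2.trans h), ⟨hbW, h.symm⟩⟩

theorem exists_isSide (hW : ConnectedOn G W) (hf : IsBridgeOf (ind G W) f) :
    ∃ X, IsSide G W f X :=
  have ⟨r, _, hr⟩ := exists_mem_verts hf.1
  ⟨nearSide G W f r, isSide_nearSide hW hf (verts_edgeSet_subset hr)⟩

namespace IsSide

theorem mem_ind (h : IsSide G W f X) : f ∈ (ind G W).edgeSet :=
  (h.inter_cut.symm.subset rfl).1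

theorem mem_cut (h : IsSide G W f X) : f ∈ cut G X :=
  (h.inter_cut.symm.subset rfl).2

theorem exists_notMem (h : IsSide G W f X) : ∃ v ∈ f, v ∉ X := by
  obtain ⟨-, a, -, b, hb, rfl⟩ := h.mem_cut
  exact ⟨b, Sym2.mem_mk_right a b, hb⟩

theorem diff (h : IsSide G W f X) : IsSide G W f (W \ X) := by
  refine ⟨Set.sdiff_subset, ?_⟩
  rw [← h.inter_cut]
  ext e
  induction e with
  | h a b =>
    simp only [Set.mem_inter_iff, mk_mem_edgeSet_ind_iff, mk_mem_cut_iff, Set.mem_sdiff]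
    tauto

theorem eq_or_mem_cut (h : IsSide G W f X) (he : e ∈ cut G X) : e = f ∨ e ∈ cut G W := by
  by_cases heW : e ∈ cut G W
  · exact .inr heW
  refine .inl (h.inter_cut.subset ⟨?_, he⟩)
  obtain ⟨hadj, a, ha, b, -, rfl⟩ := he
  refine mk_mem_edgeSet_ind_iff.2 ⟨h.subset ha, ?_, hadj⟩
  by_contra hbW
  exact heW ⟨hadj, a, h.subset ha, b, hbW, rfl⟩

theorem cut_eq_insert (h : IsSide G W f X) : cut G X = insert f (cut G W ∩ cut G X) := by
  ext e
  constructor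
  · exact fun he => (h.eq_or_mem_cut he).imp_right fun heW => ⟨heW, he⟩
  · rintro (rfl | he)
    · exact h.mem_cut
    · exact he.2

theorem inter_cut_inter_cut (h : IsSide G W f X) (hf : f ∉ F) :
    F ∩ (cut G W ∩ cut G X) = F ∩ cut G X := by
  nth_rewrite 2 [h.cut_eq_insert]
  rw [Set.inter_insert_of_notMem hf]

theorem disjoint_cut (h : IsSide G W f X) :
    Disjoint (cut G W ∩ cut G X) (cut G W ∩ cut G (W \ X)) := by
  rw [Set.disjoint_left]
  intro e
  induction e with
  | h a b =>
    simp only [Set.mem_inter_iff, mk_mem_cut_iff, Set.mem_sdiff]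
    grind [h.subset]

theorem cut_union_cut (h : IsSide G W f X) :
    cut G W ∩ cut G X ∪ cut G W ∩ cut G (W \ X) = cut G W := by
  ext e
  induction e with
  | h a b =>
    simp only [Set.mem_union, Set.mem_inter_iff, mk_mem_cut_iff, Set.mem_sdiff]
    grind [h.subset]

theorem ncard_inter_cut_add [Finite V] (h : IsSide G W f X) (F : Set (Sym2 V)) :
    (F ∩ (cut G W ∩ cut G X)).ncard + (F ∩ (cut G W ∩ cut G (W \ X))).ncard =
      (F ∩ cut G W).ncard := by
  rw [← Set.ncard_union_eq (h.disjoint_cut.mono Set.inter_subset_right Set.inter_subset_right),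
    ← Set.inter_union_distrib_left, h.cut_union_cut]

theorem nonempty_inter_cut (h : IsSide G W f X) (hF : TwoEdgeConnected G F) (hf : f ∈ F) :
    (F ∩ (cut G W ∩ cut G X)).Nonempty := by
  obtain ⟨d, hd, hne, hdX⟩ := hF.exists_ne_mem_cut hf h.mem_cut
  exact ⟨d, hd, (h.eq_or_mem_cut hdX).resolve_left hne, hdX⟩

end IsSide

theorem farSide_eq_diff_nearSide (huv : s(u, v) ∈ (ind G W).edgeSet) (hne : s(u, v) ≠ f) :
    farSide G W s(u, v) f = W \ nearSide G W f u := by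
  have huv : (fromEdgeSet ((ind G W).edgeSet \ {f})).Reachable u v :=
    reachable_of_mem ⟨huv, hne⟩ (mk_mem_edgeSet_ind_iff.1 huv).2.2.ne
  ext w
  simp only [farSide, nearSide, Set.mem_ofPred_eq, Set.mem_sdiff, Sym2.mem_iff, forall_eq_or_imp,
    forall_eq, not_and]
  exact and_congr_right fun hw =>
    ⟨fun h _ => h.1, fun h => ⟨h hw, fun hwv => h hw (hwv.trans huv.symm)⟩⟩

theorem isSide_farSide (hW : ConnectedOn G W) (hf : IsBridgeOf (ind G W) f)
    (he : e ∈ (ind G W).edgeSet) (hne : e ≠ f) : IsSide G W f (farSide G W e f) := by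
  induction e with
  | h u v =>
    rw [farSide_eq_diff_nearSide he hne]
    exact (isSide_nearSide hW hf (mk_mem_edgeSet_ind_iff.1 he).1).diff

theorem notMem_farSide (hu : u ∈ e) : u ∉ farSide G W e f := fun h => h.2 u hu (.refl u)

theorem mem_of_reachable_ind (hF : F ⊆ (ind G W).edgeSet) (h : (fromEdgeSet F).Reachable u v)
    (hu : u ∈ W) : v ∈ W := by
  by_contra hv
  obtain ⟨e, he, heW⟩ := exists_mem_cut_of_reachable (hF.trans (ind G W).edgeSet_subset) h hu hv
  exact Set.disjoint_left.1 disjoint_edgeSet_ind_cut (hF he) heW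

theorem bridgeCut_comm : bridgeCut G W e e' f = bridgeCut G W e' e f := by
  simp only [bridgeCut, or_comm]

theorem bridgeCut_eq_inter (he' : e' ∈ (ind G Wᶜ).edgeSet) :
    bridgeCut G W e e' f = cut G W ∩ cut G (farSide G W e f) := by
  ext d
  simp only [bridgeCut, Set.mem_ofPred_eq, Set.mem_inter_iff, spanningCoe_deleteEdges]
  refine and_congr_right fun hd => ⟨?_, ?_⟩
  · rintro ⟨w, hw, hwd, h⟩
    have hfar : w ∈ farSide G W e f := ⟨hw, fun u hu => h u (.inl hu)⟩
    obtain ⟨hadj, a, -, b, hb, rfl⟩ := hd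
    obtain rfl : w = a := (Sym2.mem_iff.1 hwd).resolve_right fun h => hb (h ▸ hw)
    exact ⟨hadj, w, hfar, b, fun h => hb h.1, rfl⟩
  · rintro ⟨-, w, hw, b, -, rfl⟩
    refine ⟨w, hw.1, Sym2.mem_mk_left w b, ?_⟩
    rintro u (hu | hu) hwu
    · exact hw.2 u hu hwu
    · exact verts_edgeSet_subset ⟨e', he', hu⟩ (mem_of_reachable_ind Set.sdiff_subset hwu hw.1)

theorem connectedOn_of_minimal (hG : G.Preconnected) (hS : S ≠ Set.univ)
    (hmin : Minimal (IsCut G) (cut G S)) : ConnectedOn G S := by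
  intro u hu v hv
  by_contra huv
  set A := {w | w ∈ S ∧ (fromEdgeSet (ind G S).edgeSet).Reachable u w}
  have hAS : A ⊆ S := fun w hw => hw.1
  have hvA : v ∉ A := fun h => huv h.2
  have hclosed : ∀ a ∈ A, ∀ b ∈ S, G.Adj a b → b ∈ A := fun a ha b hb hab =>
    ⟨hb, ha.2.trans (reachable_of_mem (mk_mem_edgeSet_ind_iff.2 ⟨ha.1, hb, hab⟩) hab.ne)⟩
  have hsub : cut G A ⊆ cut G S := by
    rintro e ⟨hadj, a, ha, b, hb, rfl⟩
    exact ⟨hadj, a, hAS ha, b, fun hbS => hb (hclosed a ha b hbS hadj), rfl⟩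
  have hle : cut G S ⊆ cut G A :=
    hmin.2 ⟨A, ⟨u, hu, .refl u⟩, fun h => hvA (h ▸ Set.mem_univ v), rfl⟩ hsub
  obtain ⟨t, ht⟩ := (Set.ne_univ_iff_exists_notMem S).1 hS
  obtain ⟨p⟩ := hG v t
  obtain ⟨⟨⟨x, y⟩, hxy⟩, -, ⟨hxS, hxA⟩, hy⟩ :=
    p.exists_boundary_dart (S \ A) ⟨hv, hvA⟩ fun h => ht h.1
  by_cases hyS : y ∈ S
  · have hyA : y ∈ A := by_contra fun h => hy ⟨hyS, h⟩
    exact hxA (hclosed y hyA x hxS hxy.symm)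
  · rcases (mk_mem_cut_iff.1 (hle ⟨hxy, x, hxS, y, hyS, rfl⟩)).2 with h | h
    · exact hxA h.1
    · exact hyS (hAS h.2)

theorem connectedOn_compl_of_minimal (hG : G.Preconnected) (hS : S.Nonempty)
    (hmin : Minimal (IsCut G) (cut G S)) : ConnectedOn G Sᶜ :=
  connectedOn_of_minimal hG (fun h => hS.ne_empty (Set.compl_univ_iff.1 h)) (by rwa [cut_compl])

end Sides

/-! ### Necessity, and sufficiency for a two-edge cut -/

section Necessity

variable {V : Type*} [Finite V] {G : SimpleGraph V} {S W X : Set V} {e₁ e₂ f : Sym2 V}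
  {F J K L : Set (Sym2 V)}

theorem IsRoot.ncard_inter_side (h : IsRoot G S e₁ e₂ F) (he₁ : e₁ ∈ (ind G S).edgeSet)
    (he₂ : e₂ ∈ (ind G Sᶜ).edgeSet) (hX : IsSide G S f X) (hv : ∃ v ∈ e₁, v ∉ X) :
    (F ∩ (cut G S ∩ cut G X)).ncard = (F ∩ {f}).ncard := by
  obtain ⟨hF, ⟨h₁, h₂, htwo⟩ | ⟨-, hdisj⟩⟩ := h
  · have hsum := hX.ncard_inter_cut_add F
    by_cases hf : f ∈ F
    · have hpos := (Set.ncard_pos (Set.toFinite _)).2 (hX.nonempty_inter_cut hF hf)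
      have hpos' := (Set.ncard_pos (Set.toFinite _)).2 (hX.diff.nonempty_inter_cut hF hf)
      rw [Set.inter_eq_right.2 (Set.singleton_subset_iff.2 hf), Set.ncard_singleton]
      omega
    · obtain ⟨v, hv₁, hvX⟩ := hv
      obtain ⟨w, hw₂, hwF⟩ := exists_mem_verts h₂
      have hvS : v ∈ S := verts_edgeSet_subset ⟨e₁, he₁, hv₁⟩
      have hwS : w ∈ Sᶜ := verts_edgeSet_subset ⟨e₂, he₂, hw₂⟩
      obtain ⟨d, hd, hdX⟩ := hF.exists_mem_cut (X := S \ X) ⟨e₁, h₁, hv₁⟩ hwF ⟨hvS, hvX⟩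
        fun h => hwS h.1
      have htwo' := hF.two_le_ncard_inter_cut hd hdX
      rw [← hX.diff.inter_cut_inter_cut hf] at htwo'
      rw [Set.inter_singleton_eq_empty.2 hf, Set.ncard_empty]
      omega
  · have hempty : F ∩ (cut G S ∩ cut G X) = ∅ :=
      (hdisj.mono_right Set.inter_subset_left).inter_eq
    have hf : f ∉ F := fun hf => (hX.nonempty_inter_cut hF hf).ne_empty hempty
    rw [hempty, Set.inter_singleton_eq_empty.2 hf]

namespace RootsDetermine

theorem ncard_inter_eq (h : RootsDetermine G S e₁ e₂)
    (hKL : ∀ F, IsRoot G S e₁ e₂ F → (F ∩ K).ncard = (F ∩ L).ncard) (hF : TwoEdgeConnected G F) :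
    (F ∩ K).ncard = (F ∩ L).ncard := by
  have weight_sub : ∀ F, weight (K.indicator 1 - L.indicator 1) F =
      (F ∩ K).ncard - (F ∩ L).ncard := fun F => by
    rw [← weight_one, ← weight_one, ← weight_indicator, ← weight_indicator]
    exact finsum_mem_sub_distrib _ _ (Set.toFinite F)
  have hzero := h (K.indicator 1 - L.indicator 1)
    (fun F hF => by rw [weight_sub, hKL F hF, sub_self]) F hF
  rw [weight_sub, sub_eq_zero] at hzero
  exact_mod_cast hzero

theorem ncard_cut_inter_side (h : RootsDetermine G S e₁ e₂) (hG : TwoEdgeConnected G G.edgeSet)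
    (he₁ : e₁ ∈ (ind G S).edgeSet) (he₂ : e₂ ∈ (ind G Sᶜ).edgeSet) (hX : IsSide G S f X)
    (hv : ∃ v ∈ e₁, v ∉ X) : (cut G S ∩ cut G X).ncard = 1 := by
  have heq := h.ncard_inter_eq (fun F hF => hF.ncard_inter_side he₁ he₂ hX hv) hG
  rwa [Set.inter_eq_right.2 fun e he => he.1.1, Set.inter_eq_right.2
    (Set.singleton_subset_iff.2 ((ind G S).edgeSet_subset hX.mem_ind)), Set.ncard_singleton] at heq

theorem ncard_cut_eq_two (h : RootsDetermine G S e₁ e₂) (hG : TwoEdgeConnected G G.edgeSet)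
    (hS : ConnectedOn G S) (he₂ : e₂ ∈ (ind G Sᶜ).edgeSet) (hb : IsBridgeOf (ind G S) e₁) :
    (cut G S).ncard = 2 := by
  obtain ⟨X, hX⟩ := exists_isSide hS hb
  rw [← hX.cut_union_cut, Set.ncard_union_eq hX.disjoint_cut,
    h.ncard_cut_inter_side hG hb.1 he₂ hX hX.exists_notMem,
    h.ncard_cut_inter_side hG hb.1 he₂ hX.diff hX.diff.exists_notMem]

theorem ncard_bridgeCut (h : RootsDetermine G S e₁ e₂) (hG : TwoEdgeConnected G G.edgeSet)
    (hS : ConnectedOn G S) (he₁ : e₁ ∈ (ind G S).edgeSet) (he₂ : e₂ ∈ (ind G Sᶜ).edgeSet)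
    (hb : ¬ IsBridgeOf (ind G S) e₁) (hf : IsBridgeOf (ind G S) f) :
    (bridgeCut G S e₁ e₂ f).ncard = 1 := by
  have hne : e₁ ≠ f := fun h => hb (h ▸ hf)
  obtain ⟨v, hv, -⟩ := exists_mem_verts he₁
  rw [bridgeCut_eq_inter he₂]
  exact h.ncard_cut_inter_side hG he₁ he₂ (isSide_farSide hS hf he₁ hne)
    ⟨v, hv, notMem_farSide hv⟩

end RootsDetermine

theorem IsSide.exists_cut_eq_pair (h : IsSide G W f X) (hG : TwoEdgeConnected G G.edgeSet)
    (hW : (cut G W).ncard = 2) : ∃ d ∈ cut G W, cut G X = {d, f} := by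
  have hf := (ind G W).edgeSet_subset h.mem_ind
  have hpos := (Set.ncard_pos (Set.toFinite _)).2 (h.nonempty_inter_cut hG hf)
  have hpos' := (Set.ncard_pos (Set.toFinite _)).2 (h.diff.nonempty_inter_cut hG hf)
  have hsum := h.ncard_inter_cut_add G.edgeSet
  simp only [Set.inter_eq_right.2 fun e (he : e ∈ cut G W) => he.1, ← Set.inter_assoc]
    at hpos hpos' hsum
  obtain ⟨d, hd⟩ := Set.ncard_eq_one.1 (show (cut G W ∩ cut G X).ncard = 1 by omega)
  exact ⟨d, (hd.symm.subset rfl).1, by rw [h.cut_eq_insert, hd, Set.pair_comm]⟩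

theorem TwoEdgeConnected.cut_subset (hJ : TwoEdgeConnected G J) (hS : (cut G S).ncard = 2)
    (h : ¬ Disjoint J (cut G S)) : cut G S ⊆ J := by
  obtain ⟨e, he, heS⟩ := Set.not_disjoint_iff.1 h
  exact Set.inter_eq_right.1 <| Set.eq_of_subset_of_ncard_le Set.inter_subset_right <|
    hS.trans_le (hJ.two_le_ncard_inter_cut he heS)

/-- The bridge `e₁` lies in a two-edge cut with an edge of `δ(S)`, so that all 2-edge-connected
sets through `e₂` are roots. -/
theorem rootsDetermine_of_isBridgeOf (hG : TwoEdgeConnected G G.edgeSet) (hS : ConnectedOn G S)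
    (he₂ : e₂ ∈ (ind G Sᶜ).edgeSet) (hb : IsBridgeOf (ind G S) e₁) (htwo : (cut G S).ncard = 2) :
    RootsDetermine G S e₁ e₂ := by
  obtain ⟨X, hX⟩ := exists_isSide hS hb
  obtain ⟨d, hd, hdX⟩ := hX.exists_cut_eq_pair hG htwo
  intro c hc F hF
  refine hG.weight_eq_zero_of_through ((ind G Sᶜ).edgeSet_subset he₂)
    (fun J hJ _ heJ => hc J ⟨hJ, ?_⟩) hF hF.subset
  by_cases hdisj : Disjoint J (cut G S)
  · exact .inr ⟨.inr heJ, hdisj⟩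
  · have hSJ := hJ.cut_subset htwo hdisj
    exact .inl ⟨hJ.mem_of_cut_eq_pair hdX (hSJ hd), heJ, by rw [Set.inter_eq_right.2 hSJ, htwo]⟩

end Necessity

/-! ### Cores -/

section Core

variable {V : Type*} {G : SimpleGraph V} {W : Set V} {d e f : Sym2 V} {F J : Set (Sym2 V)}
  {u v : V}

/-- The edge set of the 2-edge-connected component of `G[W]` that contains the edge `e`; it is empty
if `e` is a bridge of `G[W]`. -/
def core (G : SimpleGraph V) (W : Set V) (e : Sym2 V) : Set (Sym2 V) :=
  ⋃₀ {J | TwoEdgeConnected G J ∧ J ⊆ (ind G W).edgeSet ∧ e ∈ J}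

theorem twoEdgeConnected_core : TwoEdgeConnected G (core G W e) :=
  .sUnion (x := e.out.1) (fun _ hJ => hJ.1) fun _ hJ => ⟨e, hJ.2.2, Sym2.out_fst_mem e⟩

theorem core_subset : core G W e ⊆ (ind G W).edgeSet := Set.sUnion_subset fun _ hJ => hJ.2.1

theorem subset_core (hJ : TwoEdgeConnected G J) (hJW : J ⊆ (ind G W).edgeSet) (he : e ∈ J) :
    J ⊆ core G W e :=
  Set.subset_sUnion_of_mem ⟨hJ, hJW, he⟩

theorem verts_core_subset : verts (core G W e) ⊆ W :=
  (verts_mono core_subset).trans verts_edgeSet_subset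

theorem disjoint_core_cut : Disjoint (core G W e) (cut G W) :=
  disjoint_edgeSet_ind_cut.mono_left core_subset

theorem exists_twoEdgeConnected_of_reachable (hF : F ⊆ G.edgeSet) (huv : s(u, v) ∈ F)
    (h : (fromEdgeSet (F \ {s(u, v)})).Reachable u v) :
    ∃ J, TwoEdgeConnected G J ∧ J ⊆ F ∧ s(u, v) ∈ J := by
  obtain ⟨p, hp, hpF⟩ := exists_isPath_of_reachable (Set.sdiff_subset.trans hF) h.symm
  have hadj : G.Adj u v := hF huv
  refine ⟨(Walk.cons hadj p).edgeSet,
    .of_isTrail (hp.isTrail.cons hadj fun h => (hpF h).2 rfl), ?_, by simp⟩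
  rw [Walk.edgeSet_cons]
  exact Set.insert_subset huv (hpF.trans Set.sdiff_subset)

theorem mem_core_self (he : e ∈ (ind G W).edgeSet) (hb : ¬ IsBridgeOf (ind G W) e) :
    e ∈ core G W e := by
  induction e with
  | h a b =>
    rw [isBridgeOf_iff, not_and, not_not] at hb
    obtain ⟨J, hJ, hJW, hab⟩ :=
      exists_twoEdgeConnected_of_reachable (ind G W).edgeSet_subset he (hb he)
    exact subset_core hJ hJW hab hab

/-- The edge `e` lies on a circuit of the connected graph `G[W]`, and the far side of every bridge
of `G[W]`, seen from `e`, is left by exactly one edge of `δ(W)`. This is condition (ii) of the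
theorem for one side `W` of the cut. -/
structure IsThinSide (G : SimpleGraph V) (W : Set V) (e : Sym2 V) : Prop where
  connectedOn : ConnectedOn G W
  mem : e ∈ (ind G W).edgeSet
  not_isBridgeOf : ¬ IsBridgeOf (ind G W) e
  ncard_cut_inter : ∀ f, IsBridgeOf (ind G W) f → (cut G W ∩ cut G (farSide G W e f)).ncard = 1

theorem IsThinSide.of_ncard_bridgeCut {e' : Sym2 V} (hW : ConnectedOn G W)
    (he : e ∈ (ind G W).edgeSet) (he' : e' ∈ (ind G Wᶜ).edgeSet) (hb : ¬ IsBridgeOf (ind G W) e)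
    (hone : ∀ f, IsBridgeOf (ind G W) f → (bridgeCut G W e e' f).ncard = 1) : IsThinSide G W e :=
  ⟨hW, he, hb, fun f hf => bridgeCut_eq_inter he' ▸ hone f hf⟩

/-- The edge `f` of `G[W]` joins the core of `e` to the far side of `f`, from which only one further
edge `d` leaves, and this edge leaves `W`. -/
structure IsTether (G : SimpleGraph V) (W : Set V) (e f d : Sym2 V) : Prop where
  mem_ind : f ∈ (ind G W).edgeSet
  mem_cut_core : f ∈ cut G (verts (core G W e))
  disjoint : Disjoint (farSide G W e f) (verts (core G W e))
  mem_cut : d ∈ cut G W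
  cut_eq : cut G (farSide G W e f) = {d, f}

theorem IsTether.eq_of_mem_cut {d' : Sym2 V} (h : IsTether G W e f d) (hW : d' ∈ cut G W)
    (hX : d' ∈ cut G (farSide G W e f)) : d' = d :=
  (h.cut_eq.subset hX).resolve_right fun hf =>
    Set.disjoint_left.1 disjoint_edgeSet_ind_cut h.mem_ind (hf ▸ hW)

theorem IsTether.mem_verts_inter (h : IsTether G W e f d) (hF : TwoEdgeConnected G F) (hd : d ∈ F) :
    (verts F ∩ verts (core G W e)).Nonempty := by
  obtain ⟨-, x, hx, y, -, rfl⟩ := h.mem_cut_core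
  exact ⟨x, left_mem_verts (hF.mem_of_cut_eq_pair h.cut_eq hd), hx⟩

theorem IsTether.subset_ind_farSide (h : IsTether G W e f d) (hJ : TwoEdgeConnected G J)
    (hdisj : Disjoint (verts J) (verts (core G W e))) (hv : v ∈ verts J)
    (hvX : v ∈ farSide G W e f) : J ⊆ (ind G (farSide G W e f)).edgeSet := by
  have hd : d ∉ J := fun hd =>
    Set.not_disjoint_iff_nonempty_inter.2 (h.mem_verts_inter hJ hd) hdisj
  refine hJ.subset_edgeSet_ind ?_ hv hvX
  rw [h.cut_eq, Set.disjoint_right]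
  rintro g (rfl | rfl) hg
  · exact hd hg
  · exact hd (hJ.mem_of_cut_eq_pair (h.cut_eq.trans (Set.pair_comm _ _)) hg)

namespace IsThinSide

theorem mem_core (h : IsThinSide G W e) : e ∈ core G W e := mem_core_self h.mem h.not_isBridgeOf

theorem subset_core (h : IsThinSide G W e) (hJ : TwoEdgeConnected G J)
    (hJW : J ⊆ (ind G W).edgeSet) (hv : v ∈ verts J) (hvc : v ∈ verts (core G W e)) :
    J ⊆ core G W e :=
  Set.subset_union_left.trans <| TECS.subset_core (hJ.union twoEdgeConnected_core hv hvc)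
    (Set.union_subset hJW core_subset) (.inr h.mem_core)

theorem isBridgeOf_of_notMem_core (h : IsThinSide G W e) (hf : s(u, v) ∈ (ind G W).edgeSet)
    (hu : u ∈ verts (core G W e)) (hfc : s(u, v) ∉ core G W e) :
    IsBridgeOf (ind G W) s(u, v) := by
  refine isBridgeOf_iff.2 ⟨hf, fun hreach => hfc ?_⟩
  obtain ⟨J, hJ, hJW, huv⟩ :=
    exists_twoEdgeConnected_of_reachable (ind G W).edgeSet_subset hf hreach
  exact h.subset_core hJ hJW (left_mem_verts huv) hu huv

theorem ind_verts_core_subset (h : IsThinSide G W e) :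
    (ind G (verts (core G W e))).edgeSet ⊆ core G W e := by
  intro f hf
  induction f with
  | h u v =>
    by_contra hfc
    obtain ⟨hu, hv, hadj⟩ := mk_mem_edgeSet_ind_iff.1 hf
    have hfW := mk_mem_edgeSet_ind_iff.2 ⟨verts_core_subset hu, verts_core_subset hv, hadj⟩
    exact (isBridgeOf_iff.1 (h.isBridgeOf_of_notMem_core hfW hu hfc)).2 <|
      reachable_mono (Set.subset_sdiff_singleton core_subset hfc)
        (twoEdgeConnected_core.reachable hu hv)

theorem exists_isTether_of_mem_cut_core (h : IsThinSide G W e) (hf : f ∈ (ind G W).edgeSet)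
    (hfc : f ∈ cut G (verts (core G W e))) : IsBridgeOf (ind G W) f ∧ ∃ d, IsTether G W e f d := by
  have hf_core : f ∉ core G W e := fun hmem => by
    obtain ⟨-, a, -, b, hb, rfl⟩ := hfc
    exact hb (right_mem_verts hmem)
  have hb : IsBridgeOf (ind G W) f := by
    obtain ⟨-, a, ha, b, -, rfl⟩ := hfc
    exact h.isBridgeOf_of_notMem_core hf ha hf_core
  obtain ⟨d, hd⟩ := Set.ncard_eq_one.1 (h.ncard_cut_inter f hb)
  have hside := isSide_farSide h.connectedOn hb h.mem fun hef => hf_core (hef ▸ h.mem_core)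
  obtain ⟨x, hxe, hx⟩ := exists_mem_verts h.mem_core
  refine ⟨hb, d, hf, hfc, Set.disjoint_left.2 fun a ha hac => ha.2 x hxe ?_,
    (hd.symm.subset rfl).1, by rw [hside.cut_eq_insert, hd, Set.pair_comm]⟩
  exact reachable_mono (Set.subset_sdiff_singleton core_subset hf_core)
    (twoEdgeConnected_core.reachable hac hx)

theorem exists_isTether (h : IsThinSide G W e) (hv : v ∈ W) (hvc : v ∉ verts (core G W e)) :
    ∃ f d, IsTether G W e f d ∧ v ∈ farSide G W e f := by
  obtain ⟨x, -, hx⟩ := exists_mem_verts h.mem_core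
  obtain ⟨p, hp, hpW⟩ := exists_isPath_of_reachable (ind G W).edgeSet_subset
    (h.connectedOn v hv x (verts_core_subset hx))
  obtain ⟨z, hz, q, r, rfl, hq, -⟩ := exists_append_first_visit p ⟨x, p.end_mem_support, hx⟩
  replace hp : q.reverse.IsPath := hp.of_append_left.reverse
  replace hpW : q.reverse.edgeSet ⊆ (ind G W).edgeSet := by
    rw [Walk.edgeSet_reverse]
    exact (Walk.edgeSet_append q r ▸ Set.subset_union_left).trans hpW
  replace hq : ∀ a ∈ q.reverse.support, a ∈ verts (core G W e) → a = z := by simpa using hq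
  generalize q.reverse = t at hp hpW hq
  cases t with
  | nil => exact absurd hz hvc
  | @cons _ y _ hadj t =>
  rw [Walk.edgeSet_cons, Set.insert_subset_iff] at hpW
  have hy : y ∉ verts (core G W e) := fun hyc => hadj.ne (hq y (by simp) hyc).symm
  obtain ⟨hb, d, hd⟩ := h.exists_isTether_of_mem_cut_core hpW.1 ⟨hadj, z, hz, y, hy, rfl⟩
  refine ⟨s(z, y), d, hd, hv, fun w hw hvw => (isBridgeOf_iff.1 hb).2 ?_⟩
  have hzw : (fromEdgeSet ((ind G W).edgeSet \ {s(z, y)})).Reachable z w :=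
    reachable_mono (Set.subset_sdiff_singleton core_subset fun hmem => hy (right_mem_verts hmem))
      (twoEdgeConnected_core.reachable hz ⟨e, h.mem_core, hw⟩)
  have hyv : (fromEdgeSet ((ind G W).edgeSet \ {s(z, y)})).Reachable y v :=
    reachable_of_edgeSet_subset t <| Set.subset_sdiff_singleton hpW.2 fun hmem =>
      (Walk.cons_isPath_iff hadj t |>.1 hp).2 (t.fst_mem_support_of_mem_edges hmem)
  exact hzw.trans (hvw.symm.trans hyv.symm)

theorem mem_cut_core_or_exists_isTether (h : IsThinSide G W e) (hd : d ∈ cut G W) :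
    d ∈ cut G (verts (core G W e)) ∨ ∃ f, IsTether G W e f d := by
  obtain ⟨hadj, a, ha, b, hb, rfl⟩ := id hd
  by_cases hac : a ∈ verts (core G W e)
  · exact .inl ⟨hadj, a, hac, b, fun hbc => hb (verts_core_subset hbc), rfl⟩
  · obtain ⟨f, d, hf, hfar⟩ := h.exists_isTether ha hac
    exact .inr ⟨f, hf.eq_of_mem_cut hd ⟨hadj, a, hfar, b, fun hbX => hb hbX.1, rfl⟩ ▸ hf⟩

theorem exists_mem_verts_core (h : IsThinSide G W e) (hF : TwoEdgeConnected G F)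
    (hFW : ¬ Disjoint F (cut G W)) : (verts F ∩ verts (core G W e)).Nonempty := by
  obtain ⟨d, hd, hdW⟩ := Set.not_disjoint_iff.1 hFW
  rcases h.mem_cut_core_or_exists_isTether hdW with ⟨-, a, ha, b, -, rfl⟩ | ⟨f, hf⟩
  · exact ⟨a, left_mem_verts hd, ha⟩
  · exact hf.mem_verts_inter hF hd

theorem union_core (h : IsThinSide G W e) (hF : TwoEdgeConnected G F)
    (hFW : ¬ Disjoint F (cut G W)) : TwoEdgeConnected G (F ∪ core G W e) :=
  have ⟨_, hx, hxc⟩ := h.exists_mem_verts_core hF hFW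
  hF.union twoEdgeConnected_core hx hxc

theorem not_disjoint_cut (h : IsThinSide G W e) (hF : TwoEdgeConnected G F)
    (hu : u ∈ verts F) (huc : u ∈ verts (core G W e)) (hv : v ∈ verts F)
    (hvc : v ∉ verts (core G W e)) : ¬ Disjoint F (cut G W) := by
  rw [Set.not_disjoint_iff]
  by_cases hvW : v ∈ W
  · obtain ⟨f, d, hf, hvX⟩ := h.exists_isTether hvW hvc
    obtain ⟨g, hg, hgX⟩ := hF.exists_mem_cut hv hu hvX fun huX =>
      Set.disjoint_left.1 hf.disjoint huX huc
    rcases hf.cut_eq.subset hgX with rfl | rfl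
    · exact ⟨g, hg, hf.mem_cut⟩
    · exact ⟨d, hF.mem_of_cut_eq_pair (hf.cut_eq.trans (Set.pair_comm _ _)) hg, hf.mem_cut⟩
  · exact hF.exists_mem_cut hu hv (verts_core_subset huc) hvW

/-- The map sending an edge of `δ(W)` to itself or to its tether is injective. -/
theorem ncard_inter_cut_le [Finite V] (h : IsThinSide G W e) (hF : TwoEdgeConnected G F) :
    (F ∩ cut G W).ncard ≤ (F ∩ cut G (verts (core G W e))).ncard := by
  have exists_image : ∀ d ∈ F ∩ cut G W, ∃ g ∈ F ∩ cut G (verts (core G W e)),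
      g = d ∨ IsTether G W e g d := by
    rintro d ⟨hd, hdW⟩
    rcases h.mem_cut_core_or_exists_isTether hdW with hdc | ⟨f, hf⟩
    · exact ⟨d, ⟨hd, hdc⟩, .inl rfl⟩
    · exact ⟨f, ⟨hF.mem_of_cut_eq_pair hf.cut_eq hd, hf.mem_cut_core⟩, .inr hf⟩
  choose! φ hφ hφ' using exists_image
  refine Set.ncard_le_ncard_of_injOn φ hφ fun d hd d' hd' heq => ?_
  have not_isTether : ∀ {g g'}, g ∈ cut G W → ¬ IsTether G W e g g' := fun hg hgg' =>
    Set.disjoint_left.1 disjoint_edgeSet_ind_cut hgg'.mem_ind hg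
  rcases hφ' d hd with h₁ | h₁ <;> rcases hφ' d' hd' with h₂ | h₂
  · rw [← h₁, ← h₂, heq]
  · exact absurd (heq ▸ h₂) (not_isTether (h₁.symm ▸ hd.2))
  · exact absurd (heq ▸ h₁) (not_isTether (h₂.symm ▸ hd'.2))
  · exact h₂.eq_of_mem_cut hd.2 (heq ▸ h₁.cut_eq.symm.subset (.inl rfl))

end IsThinSide

end Core

section Extension

variable {V : Type*} {G : SimpleGraph V} {A X : Set V} {T : Set (Sym2 V)} {u v : V}

theorem exists_reachable_ind_diff (hG : TwoEdgeConnected G G.edgeSet) (hX : cut G X ⊆ T)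
    (hne : (cut G X).Nonempty) (hu : u ∈ verts (ind G X).edgeSet) (e : Sym2 V) :
    ∃ t ∈ verts T, (fromEdgeSet ((ind G X).edgeSet \ {e})).Reachable u t := by
  obtain ⟨_, hadj, a, -, b, hb, rfl⟩ := hne
  set A := {w | w ∈ X ∧ (fromEdgeSet ((ind G X).edgeSet \ {e})).Reachable u w}
  have huX : u ∈ X := verts_edgeSet_subset hu
  obtain ⟨_, ⟨hdG, hde⟩, -, y, ⟨hyX, hy⟩, z, hz, rfl⟩ := exists_mem_cut_of_reachable (X := A)
    Set.sdiff_subset (hG.reachable_diff (verts_mono (ind G X).edgeSet_subset hu)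
      (right_mem_verts hadj) e) ⟨huX, .refl u⟩ fun h => hb h.1
  refine ⟨y, left_mem_verts (hX ⟨hdG, y, hyX, z, fun hzX => hz ⟨hzX, hy.trans ?_⟩, rfl⟩), hy⟩
  exact reachable_of_mem ⟨mk_mem_edgeSet_ind_iff.2 ⟨hyX, hzX, hdG⟩, hde⟩ (G.ne_of_adj hdG)

theorem TwoEdgeConnected.union_ind (hG : TwoEdgeConnected G G.edgeSet) (hT : TwoEdgeConnected G T)
    (hX : cut G X ⊆ T) (hne : (cut G X).Nonempty) :
    TwoEdgeConnected G (T ∪ (ind G X).edgeSet) where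
  subset := Set.union_subset hT.subset (ind G X).edgeSet_subset
  isEdgeReachable u hu v hv := by
    refine isEdgeReachable_two_fromEdgeSet_iff.2 fun e => ?_
    have exists_reachable : ∀ w ∈ verts (T ∪ (ind G X).edgeSet),
        ∃ t ∈ verts T, (fromEdgeSet ((T ∪ (ind G X).edgeSet) \ {e})).Reachable w t := by
      intro w hw
      rw [verts_union] at hw
      rcases hw with hw | hw
      · exact ⟨w, hw, .refl w⟩
      · obtain ⟨t, ht, hwt⟩ := exists_reachable_ind_diff hG hX hne hw e
        exact ⟨t, ht, reachable_mono (Set.sdiff_subset_sdiff_left Set.subset_union_right) hwt⟩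
    obtain ⟨t, ht, hut⟩ := exists_reachable u hu
    obtain ⟨t', ht', hvt'⟩ := exists_reachable v hv
    exact hut.trans ((reachable_mono (Set.sdiff_subset_sdiff_left Set.subset_union_left)
      (hT.reachable_diff ht ht' e)).trans hvt'.symm)

/-- A trail from `A` to `A` is made up of edges inside `A` and excursions from `A`. -/
theorem weight_trail_eq_zero_of_excursions [Finite V] {c : Sym2 V → ℝ}
    (hin : ∀ e ∈ (ind G A).edgeSet, c e = 0)
    (hex : ∀ (a w b : V) (h : G.Adj a w) (q : G.Walk w b), a ∈ A → w ∉ A → b ∈ A →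
      (Walk.cons h q).IsTrail → (∀ x ∈ q.support, x ∈ A → x = b) →
      (q.edgeSet ∩ cut G A).Subsingleton → weight c (Walk.cons h q).edgeSet = 0)
    (p : G.Walk u v) (hp : p.IsTrail) (hu : u ∈ A) (hv : v ∈ A) : weight c p.edgeSet = 0 := by
  induction hn : p.length using Nat.strong_induction_on generalizing u p with
  | _ n ih =>
  cases p with
  | nil => simp [weight_empty]
  | @cons _ w _ h p =>
    by_cases hw : w ∈ A
    · obtain ⟨hp, hnot⟩ := Walk.isTrail_cons h p |>.1 hp
      rw [Walk.edgeSet_cons, ← Set.singleton_union,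
        weight_union (Set.disjoint_singleton_left.2 hnot), weight_singleton,
        hin _ (mk_mem_edgeSet_ind_iff.2 ⟨hu, hw, h⟩),
        ih p.length (by rw [← hn]; simp) p hp hw rfl, add_zero]
    · obtain ⟨b, hb, q, r, rfl, hq, hqA⟩ := exists_append_first_visit p ⟨v, p.end_mem_support, hv⟩
      rw [← Walk.cons_append, isTrail_append_iff] at hp
      have hlen : r.length < n := by
        rw [← hn, Walk.length_cons, Walk.length_append]
        omega
      rw [← Walk.cons_append, Walk.edgeSet_append, weight_union hp.2.2,
        ih r.length hlen r hp.2.1 hb rfl, hex u w b h q hu hw hb hp.1 hq hqA, add_zero]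

end Extension

/-! ### Sufficiency when neither edge is a bridge -/

section Sufficiency

variable {V : Type*} {G : SimpleGraph V} {S : Set V} {d e₁ e₂ : Sym2 V} {F J Y : Set (Sym2 V)}
  {c : Sym2 V → ℝ}

theorem disjoint_ind_ind_compl : Disjoint (ind G S).edgeSet (ind G Sᶜ).edgeSet := by
  rw [Set.disjoint_left]
  intro e he he'
  obtain ⟨v, hv, hvS⟩ := exists_mem_verts he
  exact verts_edgeSet_subset ⟨e, he', hv⟩ (verts_edgeSet_subset hvS)

/-- Condition (ii) of the theorem: both sides of the cut `δ(S)` are thin. -/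
structure IsThinCut (G : SimpleGraph V) (S : Set V) (e₁ e₂ : Sym2 V) : Prop where
  twoEdgeConnected : TwoEdgeConnected G G.edgeSet
  left : IsThinSide G S e₁
  right : IsThinSide G Sᶜ e₂

namespace IsThinCut

theorem symm (h : IsThinCut G S e₁ e₂) : IsThinCut G Sᶜ e₂ e₁ :=
  ⟨h.twoEdgeConnected, h.right, by rw [compl_compl]; exact h.left⟩

theorem disjoint_core_compl_cut : Disjoint (core G Sᶜ e₂) (cut G S) :=
  cut_compl (G := G) S ▸ disjoint_core_cut

theorem union_core_left (h : IsThinCut G S e₁ e₂) (hF : TwoEdgeConnected G F)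
    (hFS : ¬ Disjoint F (cut G S)) : TwoEdgeConnected G (F ∪ core G S e₁) :=
  h.left.union_core hF hFS

theorem union_core_right (h : IsThinCut G S e₁ e₂) (hF : TwoEdgeConnected G F)
    (hFS : ¬ Disjoint F (cut G S)) : TwoEdgeConnected G (F ∪ core G Sᶜ e₂) :=
  h.right.union_core hF (by rwa [cut_compl])

theorem weight_core_left (h : IsThinCut G S e₁ e₂) (hc : VanishesOnRoots G S e₁ e₂ c) :
    weight c (core G S e₁) = 0 :=
  hc _ ⟨twoEdgeConnected_core, .inr ⟨.inl h.left.mem_core, disjoint_core_cut⟩⟩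

theorem weight_core_right (h : IsThinCut G S e₁ e₂) (hc : VanishesOnRoots G S e₁ e₂ c) :
    weight c (core G Sᶜ e₂) = 0 :=
  h.symm.weight_core_left (vanishesOnRoots_compl_iff.2 hc)

theorem subset_ind_left (h : IsThinCut G S e₁ e₂) (hF : TwoEdgeConnected G F)
    (hFS : Disjoint F (cut G S)) (h₁ : e₁ ∈ F) : F ⊆ (ind G S).edgeSet :=
  have ⟨_, hv, hvF⟩ := exists_mem_verts h₁
  hF.subset_edgeSet_ind hFS hvF (verts_edgeSet_subset ⟨e₁, h.left.mem, hv⟩)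

theorem subset_ind_right (h : IsThinCut G S e₁ e₂) (hF : TwoEdgeConnected G F)
    (hFS : Disjoint F (cut G S)) (h₂ : e₂ ∈ F) : F ⊆ (ind G Sᶜ).edgeSet :=
  h.symm.subset_ind_left hF (by rwa [cut_compl]) h₂

variable [Finite V]

theorem isRoot (h : IsThinCut G S e₁ e₂) (hF : TwoEdgeConnected G F) (h₁ : e₁ ∈ F) (h₂ : e₂ ∈ F)
    (hle : (F ∩ cut G S).ncard ≤ 2) : IsRoot G S e₁ e₂ F :=
  ⟨hF, .inl ⟨h₁, h₂, hle.antisymm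
    (two_le_ncard_inter_cut_of_mem hF h.left.mem h.right.mem h₁ h₂)⟩⟩

/-- The sets through `e₂` inside `Y ∪ core₁ ∪ core₂` become roots once `core₁` is added to them. -/
theorem weight_diff_core_eq_zero_of_ncard_le_two (h : IsThinCut G S e₁ e₂)
    (hc : VanishesOnRoots G S e₁ e₂ c) (hY : TwoEdgeConnected G Y) (hYS : ¬ Disjoint Y (cut G S))
    (hle : (Y ∩ cut G S).ncard ≤ 2) : weight c (Y \ core G S e₁) = 0 := by
  set R := Y ∪ core G S e₁ ∪ core G Sᶜ e₂ with hR
  have hR_conn : TwoEdgeConnected G R := h.union_core_right (h.union_core_left hY hYS)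
    fun hdisj => hYS (hdisj.mono_left Set.subset_union_left)
  have hR_le : (R ∩ cut G S).ncard ≤ 2 := by
    rwa [hR, Set.union_inter_distrib_right, Set.union_inter_distrib_right,
      disjoint_core_cut.inter_eq, disjoint_core_compl_cut.inter_eq, Set.union_empty,
      Set.union_empty]
  rw [← weight_indicator_compl]
  refine hR_conn.weight_eq_zero_of_through (g := e₂) (.inr h.right.mem_core)
    (fun I hI hIR heI => ?_) hY (Set.subset_union_left.trans Set.subset_union_left)
  rw [weight_indicator_compl]
  by_cases hIS : Disjoint I (cut G S)
  · rw [sdiff_eq_left.2 (disjoint_ind_ind_compl.symm.mono (h.subset_ind_right hI hIS heI)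
      core_subset)]
    exact hc I ⟨hI, .inr ⟨.inr heI, hIS⟩⟩
  · have hroot : IsRoot G S e₁ e₂ (I ∪ core G S e₁) := by
      refine h.isRoot (h.union_core_left hI hIS) (.inr h.left.mem_core) (.inl heI) ?_
      rw [Set.union_inter_distrib_right, disjoint_core_cut.inter_eq, Set.union_empty]
      exact (Set.ncard_le_ncard (Set.inter_subset_inter_left _ hIR)).trans hR_le
    have hsum := hc _ hroot
    rwa [weight_union_eq_add_diff, h.weight_core_left hc, zero_add] at hsum

theorem exists_mem_of_mem_cut (h : IsThinCut G S e₁ e₂) (hd : d ∈ cut G S) :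
    ∃ Y, TwoEdgeConnected G Y ∧ d ∈ Y ∧ (Y ∩ cut G S).ncard ≤ 2 := by
  obtain ⟨b, hbG, hne, hb⟩ := h.twoEdgeConnected.exists_ne_mem_cut hd.1 hd
  obtain ⟨hadj, x, hx, y, hy, rfl⟩ := id hd
  obtain ⟨hadj', x', hx', y', hy', rfl⟩ := id hb
  set F := {s(x, y), s(x', y')} ∪ ((ind G S).edgeSet ∪ (ind G Sᶜ).edgeSet) with hF
  have hFG : F ⊆ G.edgeSet := Set.union_subset (Set.pair_subset hadj hadj')
    (Set.union_subset (ind G S).edgeSet_subset (ind G Sᶜ).edgeSet_subset)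
  have hFS : F ∩ cut G S ⊆ {s(x, y), s(x', y')} := by
    rw [hF, Set.union_inter_distrib_right, Set.union_inter_distrib_right,
      disjoint_edgeSet_ind_cut.inter_eq, ← cut_compl S, disjoint_edgeSet_ind_cut.inter_eq,
      Set.union_empty, Set.union_empty]
    exact Set.inter_subset_left
  have hxx' : (fromEdgeSet (F \ {s(x, y)})).Reachable x x' :=
    reachable_mono (Set.subset_sdiff_singleton (fun g hg => .inr (.inl hg)) fun hmem =>
      Set.disjoint_left.1 disjoint_edgeSet_ind_cut hmem hd) (h.left.connectedOn x hx x' hx')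
  have hyy' : (fromEdgeSet (F \ {s(x, y)})).Reachable y' y :=
    reachable_mono (Set.subset_sdiff_singleton (fun g hg => .inr (.inr hg)) fun hmem =>
      Set.disjoint_left.1 disjoint_edgeSet_ind_cut hmem (by rwa [cut_compl]))
      (h.right.connectedOn y' hy' y hy)
  have hx'y' : (fromEdgeSet (F \ {s(x, y)})).Reachable x' y' :=
    reachable_of_mem ⟨.inl (.inr rfl), hne⟩ (G.ne_of_adj hadj')
  obtain ⟨Y, hY, hYF, hdY⟩ := exists_twoEdgeConnected_of_reachable hFG (.inl (.inl rfl))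
    (hxx'.trans (hx'y'.trans hyy'))
  refine ⟨Y, hY, hdY, (Set.ncard_le_ncard ((Set.inter_subset_inter_left _ hYF).trans hFS)).trans ?_⟩
  exact (Set.ncard_insert_le _ _).trans (by rw [Set.ncard_singleton])

/-- `J` lies in the far side of a tether, and the set `Y` crossing `δ(S)` at the end of the tether
can be extended by this far side without crossing `δ(S)` more often. -/
theorem weight_eq_zero_of_subset_ind_left (h : IsThinCut G S e₁ e₂)
    (hc : VanishesOnRoots G S e₁ e₂ c) (hJ : TwoEdgeConnected G J) (hJS : J ⊆ (ind G S).edgeSet)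
    (hdisj : Disjoint (verts J) (verts (core G S e₁))) : weight c J = 0 := by
  rcases J.eq_empty_or_nonempty with rfl | ⟨e, he⟩
  · exact weight_empty
  obtain ⟨v, -, hv⟩ := exists_mem_verts he
  obtain ⟨f, d, hf, hvX⟩ := h.left.exists_isTether (verts_edgeSet_subset (verts_mono hJS hv))
    (Set.disjoint_left.1 hdisj hv)
  set X := farSide G S e₁ f
  have hX : cut G X = {d, f} := hf.cut_eq
  obtain ⟨Y, hY, hdY, hYle⟩ := h.exists_mem_of_mem_cut hf.mem_cut
  have hXY : cut G X ⊆ Y := hX ▸ Set.pair_subset hdY (hY.mem_of_cut_eq_pair hX hdY)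
  have hR := h.twoEdgeConnected.union_ind hY hXY (hX ▸ Set.insert_nonempty d {f})
  have hX_disj : Disjoint (ind G X).edgeSet (cut G S) := by
    refine disjoint_edgeSet_ind_cut.mono_left fun g hg => ?_
    induction g with
    | h a b =>
      obtain ⟨ha, hb, hadj⟩ := mk_mem_edgeSet_ind_iff.1 hg
      exact mk_mem_edgeSet_ind_iff.2 ⟨ha.1, hb.1, hadj⟩
  rw [← sdiff_eq_left.2 (disjoint_of_disjoint_verts hdisj), ← weight_indicator_compl]
  refine hR.weight_eq_zero_of_through (g := d) (.inl hdY) (fun I hI hIR hdI => ?_) hJ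
    ((hf.subset_ind_farSide hJ hdisj hv hvX).trans Set.subset_union_right)
  rw [weight_indicator_compl]
  refine h.weight_diff_core_eq_zero_of_ncard_le_two hc hI
    (Set.not_disjoint_iff.2 ⟨d, hdI, hf.mem_cut⟩) (le_trans (Set.ncard_le_ncard ?_) hYle)
  calc I ∩ cut G S ⊆ (Y ∪ (ind G X).edgeSet) ∩ cut G S := Set.inter_subset_inter_left _ hIR
    _ = Y ∩ cut G S := by
      rw [Set.union_inter_distrib_right, hX_disj.inter_eq, Set.union_empty]

theorem weight_eq_zero_of_disjoint_verts_core (h : IsThinCut G S e₁ e₂)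
    (hc : VanishesOnRoots G S e₁ e₂ c) (hF : TwoEdgeConnected G F)
    (hdisj : Disjoint (verts F) (verts (core G S e₁))) : weight c F = 0 := by
  have hFS : Disjoint F (cut G S) := by
    by_contra hFS
    exact Set.not_disjoint_iff_nonempty_inter.2 (h.left.exists_mem_verts_core hF hFS) hdisj
  rcases F.eq_empty_or_nonempty with rfl | ⟨e, he⟩
  · exact weight_empty
  obtain ⟨v, -, hv⟩ := exists_mem_verts he
  by_cases hvS : v ∈ S
  · exact h.weight_eq_zero_of_subset_ind_left hc hF (hF.subset_edgeSet_ind hFS hv hvS) hdisj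
  have hFS' : F ⊆ (ind G Sᶜ).edgeSet := hF.subset_edgeSet_ind (by rwa [cut_compl]) hv hvS
  by_cases hdisj' : Disjoint (verts F) (verts (core G Sᶜ e₂))
  · exact h.symm.weight_eq_zero_of_subset_ind_left (vanishesOnRoots_compl_iff.2 hc) hF hFS' hdisj'
  · obtain ⟨x, hx, hxc⟩ := Set.not_disjoint_iff.1 hdisj'
    refine twoEdgeConnected_core.weight_eq_zero_of_through h.right.mem_core (fun I hI hIc heI => ?_)
      hF (h.right.subset_core hF hFS' hx hxc)
    exact hc I ⟨hI, .inr ⟨.inr heI, disjoint_core_compl_cut.mono_left hIc⟩⟩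

theorem weight_excursion_eq_zero (h : IsThinCut G S e₁ e₂) (hc : VanishesOnRoots G S e₁ e₂ c)
    {a w b : V} (hadj : G.Adj a w) (q : G.Walk w b) (ha : a ∈ verts (core G S e₁))
    (hw : w ∉ verts (core G S e₁)) (hb : b ∈ verts (core G S e₁))
    (htrail : (Walk.cons hadj q).IsTrail) (hq : ∀ x ∈ q.support, x ∈ verts (core G S e₁) → x = b)
    (hqA : (q.edgeSet ∩ cut G (verts (core G S e₁))).Subsingleton) :
    weight ((core G S e₁)ᶜ.indicator c) (Walk.cons hadj q).edgeSet = 0 := by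
  set A := verts (core G S e₁)
  set D := (Walk.cons hadj q).edgeSet
  have hD_cons : D = insert s(a, w) q.edgeSet := Walk.edgeSet_cons hadj q
  obtain ⟨p, hp, hpc⟩ := exists_isPath_of_reachable twoEdgeConnected_core.subset
    (twoEdgeConnected_core.reachable hb ha)
  have hD : Disjoint D (core G S e₁) := by
    rw [hD_cons, Set.disjoint_insert_left]
    exact ⟨fun hmem => hw (right_mem_verts hmem),
      disjoint_edgeSet_of_first_visit hq fun e he x hx => ⟨e, he, hx⟩⟩
  have hY : TwoEdgeConnected G (D ∪ p.edgeSet) := by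
    rw [← Walk.edgeSet_append]
    exact .of_isTrail (isTrail_append_iff.2 ⟨htrail, hp.isTrail, hD.mono_right hpc⟩)
  have haw : s(a, w) ∈ D ∪ p.edgeSet := .inl (by simp [D])
  have hYA : (D ∪ p.edgeSet) ∩ cut G A ⊆ insert s(a, w) (q.edgeSet ∩ cut G A) := by
    rintro g ⟨hg | hg, hgA⟩
    · rw [hD_cons] at hg
      exact hg.imp_right fun hg => ⟨hg, hgA⟩
    · obtain ⟨-, x, -, y, hy, rfl⟩ := hgA
      exact absurd (right_mem_verts (hpc hg)) hy
  have hle : ((D ∪ p.edgeSet) ∩ cut G S).ncard ≤ 2 := calc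
    _ ≤ ((D ∪ p.edgeSet) ∩ cut G A).ncard := h.left.ncard_inter_cut_le hY
    _ ≤ (insert s(a, w) (q.edgeSet ∩ cut G A)).ncard := Set.ncard_le_ncard hYA
    _ ≤ (q.edgeSet ∩ cut G A).ncard + 1 := Set.ncard_insert_le _ _
    _ ≤ 2 := Nat.succ_le_succ (Set.ncard_le_one_iff_subsingleton.2 hqA)
  have hzero := h.weight_diff_core_eq_zero_of_ncard_le_two hc hY
    (h.left.not_disjoint_cut hY (left_mem_verts haw) ha (right_mem_verts haw) hw) hle
  rwa [Set.union_sdiff_distrib, Set.sdiff_eq_empty.2 hpc, Set.union_empty,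
    ← weight_indicator_compl] at hzero

theorem weight_diff_core_left (h : IsThinCut G S e₁ e₂) (hc : VanishesOnRoots G S e₁ e₂ c)
    (hF : TwoEdgeConnected G F) : weight c (F \ core G S e₁) = 0 := by
  classical
  rw [← weight_indicator_compl]
  refine hF.weight_eq_zero_of_closed_trails fun u p hp _ => ?_
  by_cases hdisj : Disjoint (verts p.edgeSet) (verts (core G S e₁))
  · rw [weight_indicator_compl, sdiff_eq_left.2 (disjoint_of_disjoint_verts hdisj)]
    exact h.weight_eq_zero_of_disjoint_verts_core hc (.of_isTrail hp) hdisj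
  · obtain ⟨x, hx, hxc⟩ := Set.not_disjoint_iff.1 hdisj
    have hxp := mem_support_of_mem_verts hx
    rw [← edgeSet_rotate p hxp]
    refine weight_trail_eq_zero_of_excursions (fun e he => ?_)
      (fun a w b hadj q => h.weight_excursion_eq_zero hc hadj q)
      _ ((Walk.isTrail_rotate hxp).2 hp) hxc hxc
    exact Set.indicator_of_notMem (Set.notMem_compl_iff.2 (h.left.ind_verts_core_subset he)) c

theorem weight_diff_core_right (h : IsThinCut G S e₁ e₂) (hc : VanishesOnRoots G S e₁ e₂ c)
    (hF : TwoEdgeConnected G F) : weight c (F \ core G Sᶜ e₂) = 0 :=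
  h.symm.weight_diff_core_left (vanishesOnRoots_compl_iff.2 hc) hF

theorem vanishesOnRoots_indicator_compl_core (h : IsThinCut G S e₁ e₂)
    (hc : VanishesOnRoots G S e₁ e₂ c) :
    VanishesOnRoots G S e₁ e₂ ((core G Sᶜ e₂)ᶜ.indicator c) := by
  rintro J ⟨hJ, hJ_root⟩
  rw [weight_indicator_compl]
  rcases hJ_root with ⟨h₁, h₂, htwo⟩ | ⟨h₁ | h₂, hJS⟩
  · obtain ⟨v, hv, hvJ⟩ := exists_mem_verts h₂
    have hroot : IsRoot G S e₁ e₂ (J ∪ core G Sᶜ e₂) := by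
      refine h.isRoot (hJ.union twoEdgeConnected_core hvJ ⟨e₂, h.right.mem_core, hv⟩) (.inl h₁)
        (.inl h₂) ?_
      rw [Set.union_inter_distrib_right, disjoint_core_compl_cut.inter_eq, Set.union_empty, htwo]
    have hsum := hc _ hroot
    rwa [weight_union_eq_add_diff, h.weight_core_right hc, zero_add] at hsum
  · rw [sdiff_eq_left.2 (disjoint_ind_ind_compl.mono (h.subset_ind_left hJ hJS h₁) core_subset)]
    exact hc J ⟨hJ, .inr ⟨.inl h₁, hJS⟩⟩
  · rw [Set.sdiff_eq_empty.2 (subset_core hJ (h.subset_ind_right hJ hJS h₂) h₂), weight_empty]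

theorem rootsDetermine (h : IsThinCut G S e₁ e₂) : RootsDetermine G S e₁ e₂ := by
  intro c hc F hF
  set K₁ := core G S e₁
  set K₂ := core G Sᶜ e₂
  have hK : Disjoint K₁ K₂ := disjoint_ind_ind_compl.mono core_subset core_subset
  have h₁ : weight c (F \ K₁) = 0 := h.weight_diff_core_left hc hF
  have h₂ : weight c (F \ K₂) = 0 := h.weight_diff_core_right hc hF
  have h₁₂ : weight c ((F \ K₁) \ K₂) = 0 := by
    rw [← weight_indicator_compl]
    exact h.weight_diff_core_left (h.vanishesOnRoots_indicator_compl_core hc) hF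
  have hinter : (F \ K₂) ∩ K₁ = F ∩ K₁ := by
    rw [Set.sdiff_inter_right_comm, sdiff_eq_left.2 (hK.mono_left Set.inter_subset_right)]
  have hF_sum := weight_inter_add_weight_diff (c := c) (F := F) (K := K₁)
  have hdiff_sum := weight_inter_add_weight_diff (c := c) (F := F \ K₂) (K := K₁)
  rw [hinter, sdiff_right_comm] at hdiff_sum
  linarith

end IsThinCut

end Sufficiency

end TECS

theorem mainTheorem6 {V : Type*} [Finite V] (G : SimpleGraph V)
    (hG : G.IsEdgeConnected 2)
    (S : Set V) (hS : S.Nonempty) (hS' : S ≠ Set.univ)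
    (hmin : Minimal (TECS.IsCut G) (TECS.cut G S))
    (e₁ e₂ : G.edgeSet)
    (he₁ : (e₁ : Sym2 V) ∈ (TECS.ind G S).edgeSet)
    (he₂ : (e₂ : Sym2 V) ∈ (TECS.ind G Sᶜ).edgeSet) :
    TECS.DefinesFacet (TECS.TECSP G) (TECS.connectivityCutForm G S e₁ e₂) 2 ↔
      ((TECS.IsBridgeOf (TECS.ind G S) e₁ ∨ TECS.IsBridgeOf (TECS.ind G Sᶜ) e₂) ∧
          (TECS.cut G S).ncard = 2) ∨
        ((¬ TECS.IsBridgeOf (TECS.ind G S) e₁ ∧ ¬ TECS.IsBridgeOf (TECS.ind G Sᶜ) e₂) ∧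
          ∀ W : Set V, (W = S ∨ W = Sᶜ) → ∀ f : Sym2 V, TECS.IsBridgeOf (TECS.ind G W) f →
            (TECS.bridgeCut G W e₁ e₂ f).ncard = 1) := by
  have hG_two := TECS.twoEdgeConnected_edgeSet_of_isEdgeConnected hG
  have hpre := hG.preconnected (by simp)
  have hS_conn : TECS.ConnectedOn G S := TECS.connectedOn_of_minimal hpre hS' hmin
  have hSc_conn : TECS.ConnectedOn G Sᶜ := TECS.connectedOn_compl_of_minimal hpre hS hmin
  have he₁' : (e₁ : Sym2 V) ∈ (TECS.ind G Sᶜᶜ).edgeSet := by rwa [compl_compl]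
  refine (TECS.definesFacet_iff_rootsDetermine he₁ he₂).trans ⟨fun h => ?_, ?_⟩
  · have h' : TECS.RootsDetermine G Sᶜ e₂ e₁ := TECS.rootsDetermine_compl_iff.2 h
    by_cases h₁ : TECS.IsBridgeOf (TECS.ind G S) e₁
    · exact .inl ⟨.inl h₁, h.ncard_cut_eq_two hG_two hS_conn he₂ h₁⟩
    by_cases h₂ : TECS.IsBridgeOf (TECS.ind G Sᶜ) e₂
    · exact .inl ⟨.inr h₂, TECS.cut_compl (G := G) S ▸
        h'.ncard_cut_eq_two hG_two hSc_conn he₁' h₂⟩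
    refine .inr ⟨⟨h₁, h₂⟩, ?_⟩
    rintro W (rfl | rfl) f hf
    · exact h.ncard_bridgeCut hG_two hS_conn he₁ he₂ h₁ hf
    · rw [TECS.bridgeCut_comm]
      exact h'.ncard_bridgeCut hG_two hSc_conn he₂ he₁' h₂ hf
  · rintro (⟨h₁ | h₂, htwo⟩ | ⟨⟨h₁, h₂⟩, hone⟩)
    · exact TECS.rootsDetermine_of_isBridgeOf hG_two hS_conn he₂ h₁ htwo
    · exact TECS.rootsDetermine_compl_iff.1 <|
        TECS.rootsDetermine_of_isBridgeOf hG_two hSc_conn he₁' h₂ (by rwa [TECS.cut_compl])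
    · exact TECS.IsThinCut.rootsDetermine ⟨hG_two,
        .of_ncard_bridgeCut hS_conn he₁ he₂ h₁ (hone S (.inl rfl)),
        .of_ncard_bridgeCut hSc_conn he₂ he₁' h₂ fun f hf =>
          TECS.bridgeCut_comm (G := G) ▸ hone Sᶜ (.inr rfl) f hf⟩
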